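/- Notation. $|\cdot|$ is the Euclidean norm, $B_j\subset\mathbb R^N$ the closed ball of radius $j\in\mathbb N$ centred at $0$, and $I=[q_1,q_2]$ always denotes a compact interval with rational end points $q_1<q_2$. A Borel function $g:\mathbb R\times\mathbb R^N\to\mathbb R^M$ is *Carathéodory* if for every compact $K\subset\mathbb R^N$ there is $m\in L^1_{loc}(\mathbb R)$ (an *$m$-bound* of $g$ on $K$) such that for a.e. $t$, $|g(t,x)|\le m(t)$ for all $x\in K$. It is in $\mathfrak{LC}(\mathbb R^M)$ if moreover for every compact $K$ there is $l\in L^1_{loc}$ such that for a.e. $t$, $|g(t,x)-g(t,y)|\le l(t)|x-y|$ for all $x,y\in K$. A set $E$ of Carathéodory functions has *$L^1_{loc}$-equicontinuous $m$-bounds* if for each $j\in\mathbb N$ one can choose nonnegative $m$-bounds $m_g$ of the functions $g\in E$ on $B_j$ such that for all $r,\varepsilon>0$ there is $\delta>0$ with $\int_s^t m_g(u)\,du<\varepsilon$ for all $g\in E$ and all $-r\le s\le t\le r$ with $t-s<\delta$. Let $E\subset\mathfrak{LC}=\mathfrak{LC}(\mathbb R^N)$ have $L^1_{loc}$-equicontinuous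 $m$-bounds, and let $\Theta=\{\theta_j^I\}$ be the moduli of continuity $$\theta_j^I(s)=\sup_{t\in I,\ f\in E}\int_t^{t+s}\ \sup_{x\in B_j}|f(u,x)|\,du ,\qquad s\ge 0 .$$ Let $\mathcal K_j^I$ be the set of continuous $x:I\to B_j$ with $|x(s)-x(t)|\le\theta_j^I(|s-t|)$ for $s,t\in I$. A Carathéodory function $g$ is in $\mathfrak{W\Theta C}(\mathbb R^M)$ if, for all $j$ and $I$, $\int_I g(t,x_n(t))\,dt\to\int_I g(t,x(t))\,dt$ whenever $x_n,x\in\mathcal K_j^I$ and $x_n\to x$ uniformly on $I$. On $\mathfrak{LC}$ and on $\mathfrak{W\Theta C}(\mathbb R^M)$, $\sigma_\Theta$ is the topology generated by the seminorms $p_{I,j}(g)=\sup_{x\in\mathcal K_j^I}\big|\int_I g(t,x(t))\,dt\big|$, over all $I$ and $j$. For $f\in\mathfrak{LC}$, $F\in\mathfrak{W\Theta C}(\mathbb R^{N\times N})$, $h\in\mathfrak{W\Theta C}(\mathbb R^N)$ and $x_0,y_0\in\mathbb R^N$, let $x(\cdot,f,x_0)$, with maximal interval of definition $I_{f,x_0}$,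 be the (unique) maximal solution in the sense of Carathéodory of $\dot x=f(t,x)$, $x(0)=x_0$, and let $y(\cdot,f,F,h,x_0,y_0)$ be the second component of the maximal solution of the triangular system $\dot x=f(t,x)$, $\dot y=F(t,x)\,y+h(t,x)$, $x(0)=x_0$, $y(0)=y_0$. Theorem. Let $B\subset\mathfrak{W\Theta C}(\mathbb R^{N\times N})$ and $C\subset\mathfrak{W\Theta C}(\mathbb R^N)$ have $L^1_{loc}$-equicontinuous $m$-bounds. Suppose that $(f_n)$ is a sequence in $E$ converging to $f$ in $(\mathfrak{LC},\sigma_\Theta)$ and that $x_{0,n}\to x_0$ in $\mathbb R^N$. Let $[T_1,T_2]\subset I_{f,x_0}$. (i) For all large $n$, $[T_1,T_2]\subset I_{f_n,x_{0,n}}$, and $x(\cdot,f_n,x_{0,n})\to x(\cdot,f,x_0)$ uniformly on $[T_1,T_2]$. (ii) If moreover $(F_n)$ in $B$ converges to $F$ in $(\mathfrak{W\Theta C}(\mathbb R^{N\times N}),\sigma_\Theta)$, $(h_n)$ in $C$ converges to $h$ in $(\mathfrak{W\Theta C}(\mathbb R^N),\sigma_\Theta)$, and $y_{0,n}\to y_0$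 in $\mathbb R^N$, then $y(\cdot,f,F,h,x_0,y_0)$ and, for all large $n$, $y(\cdot,f_n,F_n,h_n,x_{0,n},y_{0,n})$ are defined on $[T_1,T_2]$, and $y(\cdot,f_n,F_n,h_n,x_{0,n},y_{0,n})\to y(\cdot,f,F,h,x_0,y_0)$ uniformly on $[T_1,T_2]$. -/

import Mathlib

open MeasureTheory Filter Topology Set

noncomputable section

namespace Carath

/-- The Euclidean space `ℝ^N`. -/
abbrev Eu (N : ℕ) : Type := EuclideanSpace ℝ (Fin N)

section Spaces

variable {X Y : Type*} [NormedAddCommGroup X] [MeasurableSpace X]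
  [NormedAddCommGroup Y] [MeasurableSpace Y]

/-- `m` is an `m`-bound of `f` on `K`. -/
def IsMBound (f : ℝ → X → Y) (K : Set X) (m : ℝ → ℝ) : Prop :=
  LocallyIntegrable m volume ∧ ∀ᵐ t ∂(volume : Measure ℝ), ∀ x ∈ K, ‖f t x‖ ≤ m t

/-- `l` is an `l`-bound of `f` on `K`. -/
def IsLBound (f : ℝ → X → Y) (K : Set X) (l : ℝ → ℝ) : Prop :=
  LocallyIntegrable l volume ∧
    ∀ᵐ t ∂(volume : Measure ℝ), ∀ x ∈ K, ∀ y ∈ K, ‖f t x - f t y‖ ≤ l t * ‖x - y‖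

/-- Conditions (C1) (joint Borel measurability) and (C2) (existence of `m`-bounds). -/
def IsCarath (f : ℝ → X → Y) : Prop :=
  Measurable (Function.uncurry f) ∧ ∀ K : Set X, IsCompact K → ∃ m, IsMBound f K m

/-- Lipschitz Carathéodory functions. -/
def LC (X Y : Type*) [NormedAddCommGroup X] [MeasurableSpace X]
    [NormedAddCommGroup Y] [MeasurableSpace Y] : Set (ℝ → X → Y) :=
  {f | IsCarath f ∧ ∀ K : Set X, IsCompact K → ∃ l, IsLBound f K l}

/-- A family of moduli of continuity: `Θ j q₁ q₂` is the modulus `θ_j^I` for `I = [q₁, q₂]`;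
only its values on `[0, ∞)` are used. -/
abbrev ModFamily : Type := ℕ → ℚ → ℚ → ℝ → ℝ

/-- The set `K_j^I`, `I = [q₁, q₂]`, of continuous functions from `I` to the closed ball `B_j`
that admit `θ_j^I` as a modulus of continuity (values outside `I` are irrelevant). -/
def modSet (X : Type*) [NormedAddCommGroup X] (Θ : ModFamily) (j : ℕ) (q₁ q₂ : ℚ) :
    Set (ℝ → X) :=
  {x | ContinuousOn x (Icc (q₁ : ℝ) q₂) ∧
    (∀ t ∈ Icc (q₁ : ℝ) q₂, ‖x t‖ ≤ j) ∧
    ∀ s ∈ Icc (q₁ : ℝ) q₂, ∀ t ∈ Icc (q₁ : ℝ) q₂, ‖x s - x t‖ ≤ Θ j q₁ q₂ |s - t|}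

/-- Weak `Θ`-Carathéodory functions. -/
def WTC (X Y : Type*) [NormedAddCommGroup X] [MeasurableSpace X]
    [NormedAddCommGroup Y] [NormedSpace ℝ Y] [MeasurableSpace Y] (Θ : ModFamily) :
    Set (ℝ → X → Y) :=
  {f | IsCarath f ∧ ∀ (j : ℕ) (q₁ q₂ : ℚ), q₁ < q₂ →
    ∀ (xn : ℕ → ℝ → X) (x : ℝ → X), (∀ n, xn n ∈ modSet X Θ j q₁ q₂) →
      x ∈ modSet X Θ j q₁ q₂ → TendstoUniformlyOn xn x atTop (Icc (q₁ : ℝ) q₂) →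
      Tendsto (fun n => ∫ t in Icc (q₁ : ℝ) q₂, f t (xn n t)) atTop
        (𝓝 (∫ t in Icc (q₁ : ℝ) q₂, f t (x t)))}

/-- The seminorm `p_{I,j}(f) = sup_{x ∈ K_j^I} |∫_I f(t, x(t)) dt|`, `I = [q₁, q₂]`. -/
def sigmaSeminorm [NormedSpace ℝ Y] (Θ : ModFamily) (j : ℕ) (q₁ q₂ : ℚ) (f : ℝ → X → Y) : ℝ :=
  ⨆ x : modSet X Θ j q₁ q₂, ‖∫ t in Icc (q₁ : ℝ) q₂, f t (x.1 t)‖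

/-- The topology `σ_Θ` on a space `S` of Carathéodory functions: the topology generated by the
balls of the seminorms `p_{I,j}`, where `I` runs over the compact intervals with rational end
points and `j` over `ℕ`. -/
abbrev sigmaTopology [NormedSpace ℝ Y] (Θ : ModFamily) (S : Set (ℝ → X → Y)) :
    TopologicalSpace S :=
  TopologicalSpace.generateFrom
    {U | ∃ (g : S) (j : ℕ) (q₁ q₂ : ℚ) (ε : ℝ), q₁ < q₂ ∧ 0 < ε ∧
      U = {f : S | sigmaSeminorm Θ j q₁ q₂ (fun t x => f.1 t x - g.1 t x) < ε}}

/-- `L¹_loc`-equicontinuity of a set of nonnegative locally integrable functions. -/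
def L1locEquicontinuous (S : Set (ℝ → ℝ)) : Prop :=
  (∀ m ∈ S, LocallyIntegrable m volume ∧ ∀ t, 0 ≤ m t) ∧
  ∀ r > 0, ∀ ε > 0, ∃ δ > 0, ∀ s t : ℝ, -r ≤ s → s ≤ t → t ≤ r → t - s < δ →
    ∀ m ∈ S, ∫ u in s..t, m u < ε

/-- A set `E` of Carathéodory functions has `L¹_loc`-equicontinuous `m`-bounds. -/
def HasEquicontinuousMBounds (E : Set (ℝ → X → Y)) : Prop :=
  ∀ j : ℕ, ∃ S : Set (ℝ → ℝ), L1locEquicontinuous S ∧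
    ∀ f ∈ E, ∃ m ∈ S, IsMBound f (Metric.closedBall 0 (j : ℝ)) m

/-- The optimal `m`-bound of `f` on the closed ball `B_j`. -/
def optMBound (f : ℝ → X → Y) (j : ℕ) (t : ℝ) : ℝ :=
  ⨆ x : Metric.closedBall (0 : X) (j : ℝ), ‖f t x‖

/-- The family `θ_j^I(s) = sup_{t ∈ I, f ∈ E} ∫_t^{t+s} m_f^j(u) du`, `I = [q₁, q₂]`. -/
def thetaOf (E : Set (ℝ → X → Y)) : ModFamily := fun j q₁ q₂ s =>
  sSup {a : ℝ | ∃ t ∈ Icc (q₁ : ℝ) q₂, ∃ f ∈ E, a = ∫ u in t..(t + s), optMBound f j u}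

end Spaces

section Solutions

variable {Z : Type*} [NormedAddCommGroup Z] [NormedSpace ℝ Z]

/-- `z` is a (Carathéodory) solution on `(a, b) ∋ 0` of `ż = g(t, z)`, `z(0) = z₀`. -/
def IsSolutionOn (g : ℝ → Z → Z) (z₀ : Z) (a b : ℝ) (z : ℝ → Z) : Prop :=
  a < 0 ∧ 0 < b ∧ ContinuousOn z (Ioo a b) ∧
    ∀ t ∈ Ioo a b, IntervalIntegrable (fun s => g s (z s)) volume 0 t ∧
      z t = z₀ + ∫ s in (0 : ℝ)..t, g s (z s)

/-- The maximal interval of definition `I_{g,z₀}`: the union of the open intervals around `0` on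
which a solution of the Cauchy problem `ż = g(t, z)`, `z(0) = z₀` exists. -/
def solInterval (g : ℝ → Z → Z) (z₀ : Z) : Set ℝ :=
  {t | ∃ z a b, IsSolutionOn g z₀ a b z ∧ t ∈ Ioo a b}

open Classical in
/-- The maximal solution of `ż = g(t, z)`, `z(0) = z₀` (for a problem with unique solutions): its
value at `t ∈ I_{g,z₀}` is that of a solution on an open interval containing `0` and `t`; outside
`I_{g,z₀}` it is given the value `0`. -/
def sol (g : ℝ → Z → Z) (z₀ : Z) (t : ℝ) : Z :=
  if h : ∃ z a b, IsSolutionOn g z₀ a b z ∧ t ∈ Ioo a b then h.choose t else 0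

/-- The vector field of the triangular system `ẋ = f(t, x)`, `ẏ = F(t, x) y + h(t, x)`. -/
def triangular (f : ℝ → Z → Z) (F : ℝ → Z → (Z →L[ℝ] Z)) (h : ℝ → Z → Z) :
    ℝ → Z × Z → Z × Z :=
  fun t z => (f t z.1, F t z.1 z.2 + h t z.1)

end Solutions

end Carath

end

namespace Carath

/-! The topology `σ_Θ` controls integrals of `fₙ - f` only along curves in `K_j^I`, so everything
rests on keeping the approximating curves in those sets before they are known to be solutions. Take
`j` at least one more than a bound for the limit solution `x` on a rational interval `[a, b]`, and
solve `Ẋ = fₙ(t, π X)` globally, with `π` the metric projection onto `B_j`. Since `π` is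
nonexpansive and `fₙ ∈ E`, the curve `zₙ = π Xₙ` has modulus `θ_j^I` for every `n`
(`ballProj_comp_mem_modSet`).

For (i), split `fₙ(·, zₙ) - f(·, x)` at `f(·, zₙ)`. The integral of `fₙ(·, zₙ) - f(·, zₙ)` over each
rational interval tends to zero by the seminorms; equicontinuity of the `m`-bounds makes its
primitives uniformly small (`EquiIntegrable.eventually_norm_integral_le`). The rest is absorbed by
Grönwall with an `l`-bound of the single limit `f`, so no uniform Lipschitz bound over `E` is
needed. Hence `Xₙ → x` uniformly, `Xₙ` eventually stays in `B_j`, the projection is inactive, and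
`zₙ = Xₙ` is a true solution (`exists_tendsto_solutions`).

For (ii), put `Aₙ = Fₙ(·, zₙ)` and `A = F(·, x)`. The seminorms together with the defining
continuity of `WTC` give `∫_I (Aₙ - A) → 0`, and likewise for the inhomogeneous terms. Convergence
survives multiplication by the fixed continuous `y`, and Grönwall with the coefficients `‖Aₙ‖`,
whose integrals are bounded uniformly in `n`, gives `yₙ → y`
(`eventually_norm_linear_solution_sub_le`). -/

/-! ### Grönwall's inequality through a weight function. -/

theorem intervalIntegrable_of_locallyIntegrable {Y : Type*} [NormedAddCommGroup Y] {m : ℝ → Y}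
    (hm : LocallyIntegrable m volume) (s t : ℝ) : IntervalIntegrable m volume s t :=
  (hm.integrableOn_isCompact isCompact_uIcc).intervalIntegrable

theorem locallyIntegrable_abs {m : ℝ → ℝ} (hm : LocallyIntegrable m volume) :
    LocallyIntegrable (fun t => |m t|) volume :=
  hm.mono hm.aestronglyMeasurable.norm (Eventually.of_forall fun t => by simp)

/-- Approximate `l` on `[a, b]` by a continuous `g` within `1/8` in `L¹` and take `w = cosh (4P)`,
where `P` is the primitive of `|g|` from `0`. Then `∫ |g| w = sinh (4P) / 4` exactly, so the
integral is at most `(1/4 + 1/8) w`. Continuity of `g` makes `P` differentiable everywhere, and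
evenness of `cosh` treats both sides of `0` at once. The same weight serves for Grönwall and for the
Picard contraction. -/
theorem exists_gronwall_weight {l : ℝ → ℝ} (hl : LocallyIntegrable l volume) (a b : ℝ) :
    ∃ w : ℝ → ℝ, Continuous w ∧ (∀ t, 1 ≤ w t) ∧
      (∀ t, w t ≤ Real.exp (4 * (∫ s in Icc a b, |l s|) + 1)) ∧
      ∀ t, uIoc 0 t ⊆ Icc a b → |∫ s in (0 : ℝ)..t, |l s| * w s| ≤ w t / 2 := by
  have hL : Integrable ((Icc a b).indicator l) volume :=
    (integrable_indicator_iff measurableSet_Icc).2 (hl.integrableOn_isCompact isCompact_Icc)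
  obtain ⟨g, -, hgL, hgc, hgi⟩ :=
    hL.exists_hasCompactSupport_integral_sub_le (ε := 1 / 8) (by norm_num)
  set L := (Icc a b).indicator l with hLdef
  have hLg : Integrable (fun s => ‖L s - g s‖) volume := (hL.sub hgi).norm
  have hgabs : Continuous fun s => |g s| := hgc.abs
  set P : ℝ → ℝ := fun t => ∫ s in (0 : ℝ)..t, |g s| with hP
  have hPd : ∀ t, HasDerivAt P |g t| t := fun t =>
    intervalIntegral.integral_hasDerivAt_right (hgabs.intervalIntegrable _ _)
      (hgabs.stronglyMeasurableAtFilter _ _) hgabs.continuousAt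
  have hPc : Continuous P := continuous_iff_continuousAt.2 fun t => (hPd t).continuousAt
  have hwc : Continuous fun t => Real.cosh (4 * P t) :=
    Real.continuous_cosh.comp (continuous_const.mul hPc)
  refine ⟨fun t => Real.cosh (4 * P t), hwc, fun t => Real.one_le_cosh _, fun t => ?_,
    fun t ht => ?_⟩
  · have h1 : |P t| ≤ ∫ s, |g s| := by
      rw [hP, ← Real.norm_eq_abs]
      refine (intervalIntegral.norm_integral_le_integral_norm_uIoc).trans ?_
      simp only [Real.norm_eq_abs, abs_abs]
      exact setIntegral_le_integral hgi.abs (Eventually.of_forall fun s => abs_nonneg _)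
    have h2 : ∫ s, |g s| ≤ (∫ s in Icc a b, |l s|) + 1 / 8 := by
      have h3 : ∫ s in Icc a b, |l s| = ∫ s, |L s| := by
        rw [← integral_indicator measurableSet_Icc]
        congr 1
        ext s
        by_cases hs : s ∈ Icc a b <;> simp [hLdef, hs]
      rw [h3]
      calc ∫ s, |g s| ≤ ∫ s, (|L s| + ‖L s - g s‖) := by
            refine integral_mono hgi.abs (hL.abs.add hLg) fun s => ?_
            have := abs_sub_abs_le_abs_sub (g s) (L s)
            rw [abs_sub_comm] at this
            simp only [Real.norm_eq_abs]
            linarith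
        _ = (∫ s, |L s|) + ∫ s, ‖L s - g s‖ := integral_add hL.abs hLg
        _ ≤ _ := by linarith
    have h4 : Real.cosh (4 * P t) ≤ Real.exp |4 * P t| := by
      rw [← Real.cosh_abs, Real.cosh_eq]
      have : Real.exp (-|4 * P t|) ≤ Real.exp |4 * P t| :=
        Real.exp_le_exp.2 (by linarith [abs_nonneg (4 * P t)])
      linarith
    refine h4.trans (Real.exp_le_exp.2 ?_)
    rw [abs_mul, abs_of_pos (by norm_num : (0 : ℝ) < 4)]
    linarith
  -- `|P|` grows away from `0` on either side, so `w s` can be replaced by `w t` in the error term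
  -- `|l - g| w`.
  · have hmono : ∀ s ∈ uIoc 0 t, Real.cosh (4 * P s) ≤ Real.cosh (4 * P t) := by
      intro s hs
      rw [Real.cosh_le_cosh, abs_mul, abs_mul]
      refine mul_le_mul_of_nonneg_left ?_ (abs_nonneg _)
      refine intervalIntegral.abs_integral_mono_interval ?_
        (Eventually.of_forall fun s => abs_nonneg _) (hgabs.intervalIntegrable _ _)
      exact uIoc_subset_uIoc_of_uIcc_subset_uIcc
        (uIcc_subset_uIcc left_mem_uIcc (uIoc_subset_uIcc hs))
    have hI1 : IntervalIntegrable (fun s => |g s| * Real.cosh (4 * P s)) volume 0 t :=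
      (hgabs.mul hwc).intervalIntegrable _ _
    have hI2 : IntervalIntegrable (fun s => ‖L s - g s‖ * Real.cosh (4 * P t)) volume 0 t :=
      (hLg.mul_const _).intervalIntegrable
    have h1 : |∫ s in (0 : ℝ)..t, |l s| * Real.cosh (4 * P s)| ≤
        |∫ s in (0 : ℝ)..t, (|g s| * Real.cosh (4 * P s) + ‖L s - g s‖ * Real.cosh (4 * P t))| := by
      rw [← Real.norm_eq_abs]
      refine intervalIntegral.norm_integral_le_abs_of_norm_le ?_ (hI1.add hI2)
      refine (ae_restrict_iff' measurableSet_uIoc).2 (Eventually.of_forall fun s hs => ?_)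
      have hLs : L s = l s := by simp [hLdef, ht hs]
      have hc := Real.cosh_pos (4 * P s)
      have h5 : |l s| ≤ |g s| + ‖L s - g s‖ := by
        have := abs_sub_abs_le_abs_sub (l s) (g s)
        rw [hLs, Real.norm_eq_abs]; linarith
      rw [Real.norm_eq_abs, abs_mul, abs_abs, abs_of_pos hc]
      calc |l s| * Real.cosh (4 * P s) ≤ (|g s| + ‖L s - g s‖) * Real.cosh (4 * P s) := by gcongr
        _ = |g s| * Real.cosh (4 * P s) + ‖L s - g s‖ * Real.cosh (4 * P s) := by ring
        _ ≤ _ := by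
          have := hmono s hs
          gcongr
    have h2 : ∫ s in (0 : ℝ)..t, |g s| * Real.cosh (4 * P s) = Real.sinh (4 * P t) / 4 := by
      have hd : ∀ s ∈ uIcc 0 t, HasDerivAt (fun s => Real.sinh (4 * P s) / 4)
          (|g s| * Real.cosh (4 * P s)) s := by
        intro s _
        exact ((((hPd s).const_mul 4).sinh).div_const 4).congr_deriv (by ring)
      rw [intervalIntegral.integral_eq_sub_of_hasDerivAt hd hI1]
      simp [hP]
    have h3 : |∫ s in (0 : ℝ)..t, ‖L s - g s‖| ≤ 1 / 8 := by
      rw [← Real.norm_eq_abs]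
      refine (intervalIntegral.norm_integral_le_integral_norm_uIoc).trans ?_
      simp only [norm_norm]
      exact (setIntegral_le_integral hLg (Eventually.of_forall fun s => norm_nonneg _)).trans hgL
    have h4 : |Real.sinh (4 * P t)| ≤ Real.cosh (4 * P t) := by
      rw [Real.abs_sinh, ← Real.cosh_abs]
      exact (Real.sinh_lt_cosh _).le
    have hc := Real.cosh_pos (4 * P t)
    refine h1.trans ?_
    rw [intervalIntegral.integral_add hI1 hI2, h2, intervalIntegral.integral_mul_const]
    refine (abs_add_le _ _).trans ?_
    rw [abs_div, abs_mul, abs_of_pos hc, abs_of_pos (by norm_num : (0 : ℝ) < 4)]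
    have : |∫ s in (0 : ℝ)..t, ‖L s - g s‖| * Real.cosh (4 * P t)
        ≤ 1 / 8 * Real.cosh (4 * P t) := by gcongr
    linarith

/-- Grönwall's inequality with a locally integrable coefficient, on an interval around `0`. -/
theorem gronwall_le {l u : ℝ → ℝ} (hl : LocallyIntegrable l volume) {a b C : ℝ} (ha : a ≤ 0)
    (hb : 0 ≤ b) (hu : ContinuousOn u (Icc a b)) (hu0 : ∀ t ∈ Icc a b, 0 ≤ u t) (hC : 0 ≤ C)
    (h : ∀ t ∈ Icc a b, u t ≤ C + |∫ s in (0 : ℝ)..t, |l s| * u s|) :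
    ∀ t ∈ Icc a b, u t ≤ 2 * C * Real.exp (4 * (∫ s in Icc a b, |l s|) + 1) := by
  obtain ⟨w, hwc, hw1, hwe, hwi⟩ := exists_gronwall_weight hl a b
  have hw0 : ∀ t, 0 < w t := fun t => zero_lt_one.trans_le (hw1 t)
  -- At a maximum point `τ` of `u / w`, with value `S`, the hypothesis reads `S w(τ) ≤ C + S w(τ) /
  -- 2`; the integral is absorbed and `S ≤ 2C` because `w ≥ 1`.
  obtain ⟨τ, hτ, hmax⟩ := isCompact_Icc.exists_isMaxOn ⟨0, ha, hb⟩
    (hu.div hwc.continuousOn fun t _ => (hw0 t).ne')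
  set S := u τ / w τ with hS
  have hS0 : 0 ≤ S := div_nonneg (hu0 τ hτ) (hw0 τ).le
  have huS : ∀ t ∈ Icc a b, u t ≤ S * w t := fun t ht =>
    (div_le_iff₀ (hw0 t)).1 (hmax ht)
  have hsub : uIoc 0 τ ⊆ Icc a b :=
    uIoc_subset_uIcc.trans (uIcc_subset_Icc ⟨ha, hb⟩ hτ)
  have h1 : |∫ s in (0 : ℝ)..τ, |l s| * u s| ≤ S * (w τ / 2) := by
    calc |∫ s in (0 : ℝ)..τ, |l s| * u s| ≤ |∫ s in (0 : ℝ)..τ, S * (|l s| * w s)| := by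
          rw [← Real.norm_eq_abs]
          refine intervalIntegral.norm_integral_le_abs_of_norm_le ?_ ?_
          · refine (ae_restrict_iff' measurableSet_uIoc).2 (Eventually.of_forall fun s hs => ?_)
            have := huS s (hsub hs)
            rw [Real.norm_eq_abs, abs_mul, abs_abs, abs_of_nonneg (hu0 s (hsub hs))]
            calc |l s| * u s ≤ |l s| * (S * w s) := by gcongr
              _ = _ := by ring
          · exact ((intervalIntegrable_of_locallyIntegrable (locallyIntegrable_abs hl) 0 τ).mul_continuousOn
              hwc.continuousOn).const_mul _
      _ = S * |∫ s in (0 : ℝ)..τ, |l s| * w s| := by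
          rw [intervalIntegral.integral_const_mul, abs_mul, abs_of_nonneg hS0]
      _ ≤ _ := by
          have := hwi τ hsub
          gcongr
  have h2 : S ≤ 2 * C := by
    have h3 : S * w τ = u τ := div_mul_cancel₀ _ (hw0 τ).ne'
    have h4 := h τ hτ
    have h5 : S * w τ ≤ 2 * C * w τ := by nlinarith [hw1 τ]
    exact le_of_mul_le_mul_right h5 (hw0 τ)
  intro t ht
  calc u t ≤ S * w t := huS t ht
    _ ≤ _ := mul_le_mul h2 (hwe t) (hw0 t).le (by positivity)

theorem locallyIntegrable_of_norm_le {Y : Type*} [NormedAddCommGroup Y] {f : ℝ → Y} {m : ℝ → ℝ}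
    (hf : AEStronglyMeasurable f volume) (hm : LocallyIntegrable m volume)
    (h : ∀ᵐ t, ‖f t‖ ≤ m t) : LocallyIntegrable f volume :=
  hm.mono hf (h.mono fun _ ht => ht.trans (le_abs_self _))

theorem locallyIntegrable_mul_continuous {m c : ℝ → ℝ} (hm : LocallyIntegrable m volume)
    (hc : Continuous c) : LocallyIntegrable (fun t => m t * c t) volume :=
  locallyIntegrable_iff.2 fun _ hK =>
    (hm.integrableOn_isCompact hK).mul_continuousOn hc.continuousOn hK

/-! ### Carathéodory existence by a weighted contraction. -/

section Existence

variable {Z : Type*} [NormedAddCommGroup Z] [NormedSpace ℝ Z] [MeasurableSpace Z] [BorelSpace Z]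
  [SecondCountableTopology Z]

/-- Global existence of Carathéodory solutions for a globally Lipschitz vector field. -/
theorem exists_integral_solution [CompleteSpace Z] {g : ℝ → Z → Z}
    (hg : Measurable (Function.uncurry g)) {k l : ℝ → ℝ} (hk : LocallyIntegrable k volume)
    (hl : LocallyIntegrable l volume) (hgk : ∀ᵐ t, ‖g t 0‖ ≤ k t)
    (hgl : ∀ᵐ t, ∀ x y, ‖g t x - g t y‖ ≤ l t * ‖x - y‖) {a b : ℝ} (ha : a ≤ 0) (hb : 0 ≤ b)
    (z₀ : Z) :
    ∃ z : ℝ → Z, Continuous z ∧ LocallyIntegrable (fun s => g s (z s)) volume ∧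
      ∀ t ∈ Icc a b, z t = z₀ + ∫ s in (0 : ℝ)..t, g s (z s) := by
  have hloc : ∀ z : ℝ → Z, Continuous z → LocallyIntegrable (fun s => g s (z s)) volume := by
    intro z hz
    refine locallyIntegrable_of_norm_le (m := fun s => k s + l s * ‖z s‖)
      (hg.comp (measurable_id.prodMk hz.measurable)).aestronglyMeasurable
      (hk.add (locallyIntegrable_mul_continuous hl hz.norm)) ?_
    filter_upwards [hgk, hgl] with t h1 h2
    have h3 := h2 (z t) 0
    rw [sub_zero] at h3
    calc ‖g t (z t)‖ = ‖g t 0 + (g t (z t) - g t 0)‖ := by congr 1; abel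
      _ ≤ ‖g t 0‖ + ‖g t (z t) - g t 0‖ := norm_add_le _ _
      _ ≤ _ := add_le_add h1 h3
  obtain ⟨w, hwc, hw1, -, hwi⟩ := exists_gronwall_weight hl a b
  have hw0 : ∀ t, 0 < w t := fun t => zero_lt_one.trans_le (hw1 t)
  have hab : a ≤ b := ha.trans hb
  have hext : ∀ v : C(Icc a b, Z), Continuous fun s => w s • IccExtend hab v s := fun v =>
    hwc.smul v.continuous.Icc_extend'
  -- The unknown is `v = z / w`. In this variable the weighted norm is the plain sup norm, and the
  -- Picard operator contracts by `1/2` on all of `[a, b]`, without subdividing the interval.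
  have hcont : ∀ v : C(Icc a b, Z), Continuous fun t : Icc a b =>
      (w t)⁻¹ • (z₀ + ∫ s in (0 : ℝ)..t, g s (w s • IccExtend hab v s)) := by
    intro v
    have h1 : Continuous fun t : ℝ => ∫ s in (0 : ℝ)..t, g s (w s • IccExtend hab v s) :=
      intervalIntegral.continuous_primitive
        (fun s t => intervalIntegrable_of_locallyIntegrable (hloc _ (hext v)) s t) 0
    exact ((hwc.inv₀ fun t => (hw0 t).ne').smul (continuous_const.add h1)).comp
      continuous_subtype_val
  let Φ : C(Icc a b, Z) → C(Icc a b, Z) := fun v => ⟨_, hcont v⟩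
  have hΦ : ContractingWith (1 / 2) Φ := by
    refine ⟨by norm_num [← NNReal.coe_lt_coe], LipschitzWith.of_dist_le_mul fun v v' => ?_⟩
    have hd0 : 0 ≤ dist v v' := dist_nonneg
    refine (ContinuousMap.dist_le (by positivity)).2 fun t => ?_
    have hsub : uIoc 0 (t : ℝ) ⊆ Icc a b :=
      uIoc_subset_uIcc.trans (uIcc_subset_Icc ⟨ha, hb⟩ t.2)
    have h1 : ‖∫ s in (0 : ℝ)..t, (g s (w s • IccExtend hab v s)
        - g s (w s • IccExtend hab v' s))‖ ≤ |∫ s in (0 : ℝ)..t, dist v v' * (|l s| * w s)| := by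
      refine intervalIntegral.norm_integral_le_abs_of_norm_le (ae_restrict_of_ae ?_)
        (intervalIntegrable_of_locallyIntegrable
          (locallyIntegrable_mul_continuous (locallyIntegrable_abs hl) hwc) _ _ |>.const_mul _)
      filter_upwards [hgl] with s hs
      refine (hs _ _).trans ?_
      rw [← smul_sub, norm_smul, Real.norm_eq_abs, abs_of_pos (hw0 s), ← dist_eq_norm]
      have h2 : dist (IccExtend hab v s) (IccExtend hab v' s) ≤ dist v v' :=
        ContinuousMap.dist_apply_le_dist _
      have h3 := hw0 s
      calc l s * (w s * dist (IccExtend hab v s) (IccExtend hab v' s))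
          ≤ |l s| * (w s * dist v v') := by
            gcongr
            exact le_abs_self _
        _ = _ := by ring
    rw [intervalIntegral.integral_const_mul, abs_mul, abs_of_nonneg hd0] at h1
    change dist ((w t)⁻¹ • (z₀ + ∫ s in (0 : ℝ)..t, g s (w s • IccExtend hab v s)))
      ((w t)⁻¹ • (z₀ + ∫ s in (0 : ℝ)..t, g s (w s • IccExtend hab v' s))) ≤ _
    rw [dist_eq_norm, ← smul_sub, add_sub_add_left_eq_sub, ← intervalIntegral.integral_sub
      (intervalIntegrable_of_locallyIntegrable (hloc _ (hext v)) _ _)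
      (intervalIntegrable_of_locallyIntegrable (hloc _ (hext v')) _ _), norm_smul, norm_inv,
      Real.norm_eq_abs, abs_of_pos (hw0 t), inv_mul_le_iff₀ (hw0 t)]
    refine h1.trans ?_
    have := hwi t hsub
    push_cast
    calc dist v v' * |∫ s in (0 : ℝ)..t, |l s| * w s| ≤ dist v v' * (w t / 2) := by gcongr
      _ = _ := by ring
  obtain ⟨v, hv⟩ : ∃ v, Φ v = v := ⟨_, hΦ.fixedPoint_isFixedPt⟩
  refine ⟨_, hext v, hloc _ (hext v), fun t ht => ?_⟩
  have h1 : (w t)⁻¹ • (z₀ + ∫ s in (0 : ℝ)..t, g s (w s • IccExtend hab v s)) = v ⟨t, ht⟩ :=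
    congrArg (fun u : C(Icc a b, Z) => u ⟨t, ht⟩) hv
  change w t • IccExtend hab v t = _
  rw [IccExtend_of_mem hab _ ht, ← h1, smul_inv_smul₀ (hw0 t).ne']

end Existence

/-! ### Solutions on compact intervals and the maximal solution. -/

section Solutions

variable {Z : Type*} [NormedAddCommGroup Z] [NormedSpace ℝ Z]

/-- `z` is a (Carathéodory) solution on `[a, b]` of `ż = g(t, z)`, `z(0) = z₀`. -/
def IsSolutionOnIcc (g : ℝ → Z → Z) (z₀ : Z) (a b : ℝ) (z : ℝ → Z) : Prop :=
  ContinuousOn z (Icc a b) ∧ ∀ t ∈ Icc a b, IntervalIntegrable (fun s => g s (z s)) volume 0 t ∧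
    z t = z₀ + ∫ s in (0 : ℝ)..t, g s (z s)

/-- Solutions of `ż = g(t, z)`, `z(0) = z₀` on compact intervals around `0` are unique. -/
def HasUniqueSolutions (g : ℝ → Z → Z) (z₀ : Z) : Prop :=
  ∀ ⦃a b : ℝ⦄, a ≤ 0 → 0 ≤ b → ∀ ⦃z₁ z₂ : ℝ → Z⦄, IsSolutionOnIcc g z₀ a b z₁ →
    IsSolutionOnIcc g z₀ a b z₂ → EqOn z₁ z₂ (Icc a b)

variable {g : ℝ → Z → Z} {z₀ : Z} {a b : ℝ} {z z' : ℝ → Z}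

theorem IsSolutionOn.isSolutionOnIcc {α β : ℝ} (h : IsSolutionOn g z₀ α β z)
    (hsub : Icc a b ⊆ Ioo α β) : IsSolutionOnIcc g z₀ a b z :=
  ⟨h.2.2.1.mono hsub, fun t ht => h.2.2.2 t (hsub ht)⟩

theorem IsSolutionOnIcc.isSolutionOn (h : IsSolutionOnIcc g z₀ a b z) (ha : a < 0) (hb : 0 < b) :
    IsSolutionOn g z₀ a b z :=
  ⟨ha, hb, h.1.mono Ioo_subset_Icc_self, fun t ht => h.2 t (Ioo_subset_Icc_self ht)⟩

theorem integral_equation_congr {t : ℝ} (hzz : EqOn z z' (uIcc 0 t))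
    (h : IntervalIntegrable (fun s => g s (z s)) volume 0 t ∧
      z t = z₀ + ∫ s in (0 : ℝ)..t, g s (z s)) :
    IntervalIntegrable (fun s => g s (z' s)) volume 0 t ∧
      z' t = z₀ + ∫ s in (0 : ℝ)..t, g s (z' s) := by
  refine ⟨h.1.congr fun s hs => ?_, ?_⟩
  · simp only [hzz (uIoc_subset_uIcc hs)]
  · rw [← hzz right_mem_uIcc, h.2]
    congr 1
    exact intervalIntegral.integral_congr fun s hs => by simp only [hzz hs]

theorem IsSolutionOnIcc.congr (h : IsSolutionOnIcc g z₀ a b z) (ha : a ≤ 0) (hb : 0 ≤ b)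
    (hzz : EqOn z z' (Icc a b)) : IsSolutionOnIcc g z₀ a b z' :=
  ⟨h.1.congr fun _ ht => (hzz ht).symm, fun t ht =>
    integral_equation_congr (hzz.mono (uIcc_subset_Icc ⟨ha, hb⟩ ht)) (h.2 t ht)⟩

/-- `sol` chooses a solution separately at each `t`; uniqueness on the compact interval between `0`
and `t` makes the choice irrelevant. -/
theorem HasUniqueSolutions.sol_eq (hu : HasUniqueSolutions g z₀) {α β : ℝ}
    (h : IsSolutionOn g z₀ α β z) {t : ℝ} (ht : t ∈ Ioo α β) : sol g z₀ t = z t := by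
  have hex : ∃ z a b, IsSolutionOn g z₀ a b z ∧ t ∈ Ioo a b := ⟨z, α, β, h, ht⟩
  rw [sol, dif_pos hex]
  obtain ⟨α', β', h', ht'⟩ := hex.choose_spec
  have key : ∀ {α β : ℝ} {z : ℝ → Z}, IsSolutionOn g z₀ α β z → t ∈ Ioo α β →
      IsSolutionOnIcc g z₀ (min 0 t) (max 0 t) z := fun h ht =>
    h.isSolutionOnIcc fun s hs => ⟨(lt_min h.1 ht.1).trans_le hs.1,
      hs.2.trans_lt (max_lt h.2.1 ht.2)⟩
  exact hu (min_le_left _ _) (le_max_left _ _) (key h' ht') (key h ht)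
    ⟨min_le_right _ _, le_max_right _ _⟩

theorem HasUniqueSolutions.isSolutionOnIcc_sol (hu : HasUniqueSolutions g z₀)
    (hsa : a ∈ solInterval g z₀) (hsb : b ∈ solInterval g z₀) :
    IsSolutionOnIcc g z₀ a b (sol g z₀) := by
  obtain ⟨z₁, α₁, β₁, h₁, ha₁⟩ := hsa
  obtain ⟨z₂, α₂, β₂, h₂, hb₂⟩ := hsb
  -- The solution reaching `a` covers the times `t ≤ 0`, the one reaching `b` the times `t ≥ 0`.
  have hcov : ∀ t ∈ Icc a b, ∃ z α β, IsSolutionOn g z₀ α β z ∧ t ∈ Ioo α β := by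
    intro t ht
    rcases le_total t 0 with h0 | h0
    · exact ⟨z₁, α₁, β₁, h₁, ha₁.1.trans_le ht.1, h0.trans_lt h₁.2.1⟩
    · exact ⟨z₂, α₂, β₂, h₂, h₂.1.trans_le h0, ht.2.trans_lt hb₂.2⟩
  refine ⟨fun t ht => ?_, fun t ht => ?_⟩
  · obtain ⟨z, α, β, h, htz⟩ := hcov t ht
    have hnear : sol g z₀ =ᶠ[𝓝 t] z := by
      filter_upwards [isOpen_Ioo.mem_nhds htz] with s hs using hu.sol_eq h hs
    exact ((h.2.2.1.continuousAt (isOpen_Ioo.mem_nhds htz)).congr hnear.symm).continuousWithinAt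
  · obtain ⟨z, α, β, h, htz⟩ := hcov t ht
    refine integral_equation_congr (fun s hs => (hu.sol_eq h ?_).symm) (h.2.2.2 t htz)
    exact (ordConnected_Ioo.uIcc_subset ⟨h.1, h.2.1⟩ htz) hs

/-- Solutions live on open intervals, which leaves room to enlarge `[T₁, T₂]` to rational end
points, as the seminorms require, and to put `0` strictly inside. -/
theorem exists_Icc_rat_subset_solInterval {T₁ T₂ : ℝ} (h : Icc T₁ T₂ ⊆ solInterval g z₀)
    (hT : T₁ ≤ T₂) : ∃ a b : ℚ, (a : ℝ) < 0 ∧ (0 : ℝ) < b ∧ Icc T₁ T₂ ⊆ Ioo (a : ℝ) b ∧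
      (a : ℝ) ∈ solInterval g z₀ ∧ (b : ℝ) ∈ solInterval g z₀ := by
  obtain ⟨z₁, α₁, β₁, h₁, ht₁⟩ := h (left_mem_Icc.2 hT)
  obtain ⟨z₂, α₂, β₂, h₂, ht₂⟩ := h (right_mem_Icc.2 hT)
  obtain ⟨a, ha1, ha2⟩ := exists_rat_btwn (lt_min h₁.1 ht₁.1)
  obtain ⟨b, hb1, hb2⟩ := exists_rat_btwn (max_lt h₂.2.1 ht₂.2)
  refine ⟨a, b, ha2.trans_le (min_le_left _ _), (le_max_left _ _).trans_lt hb1, fun t ht =>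
    ⟨(ha2.trans_le (min_le_right _ _)).trans_le ht.1,
      ht.2.trans_lt ((le_max_right _ _).trans_lt hb1)⟩,
    ⟨z₁, α₁, β₁, h₁, ha1, (ha2.trans_le (min_le_left _ _)).trans h₁.2.1⟩,
    ⟨z₂, α₂, β₂, h₂, h₂.1.trans ((le_max_left _ _).trans_lt hb1), hb2⟩⟩

theorem IsSolutionOnIcc.eqOn_of_lipschitz (h₁ : IsSolutionOnIcc g z₀ a b z)
    (h₂ : IsSolutionOnIcc g z₀ a b z') (ha : a ≤ 0) (hb : 0 ≤ b) {l : ℝ → ℝ}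
    (hl : LocallyIntegrable l volume)
    (hlip : ∀ᵐ s, s ∈ Icc a b → ‖g s (z s) - g s (z' s)‖ ≤ l s * ‖z s - z' s‖) :
    EqOn z z' (Icc a b) := by
  have hc : ContinuousOn (fun t => ‖z t - z' t‖) (Icc a b) := (h₁.1.sub h₂.1).norm
  have key := gronwall_le hl ha hb hc (fun t _ => norm_nonneg _) le_rfl (fun t ht => ?_)
  · intro t ht
    have := key t ht
    rw [mul_zero, zero_mul] at this
    exact sub_eq_zero.1 (norm_le_zero_iff.1 this)
  · have hsub : uIcc 0 t ⊆ Icc a b := uIcc_subset_Icc ⟨ha, hb⟩ ht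
    rw [zero_add, (h₁.2 t ht).2, (h₂.2 t ht).2, add_sub_add_left_eq_sub,
      ← intervalIntegral.integral_sub (h₁.2 t ht).1 (h₂.2 t ht).1]
    refine intervalIntegral.norm_integral_le_abs_of_norm_le ?_ ?_
    · refine (ae_restrict_iff' measurableSet_uIoc).2 ?_
      filter_upwards [hlip] with s hs hst
      refine (hs (hsub (uIoc_subset_uIcc hst))).trans ?_
      gcongr
      exact le_abs_self _
    · exact (intervalIntegrable_of_locallyIntegrable (locallyIntegrable_abs hl) 0 t).mul_continuousOn
        (hc.mono hsub)

end Solutions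

/-! ### Splitting the triangular system into its components. -/

section Triangular

variable {Z : Type*} [NormedAddCommGroup Z] [NormedSpace ℝ Z] [CompleteSpace Z]
  {f : ℝ → Z → Z} {F : ℝ → Z → (Z →L[ℝ] Z)} {h : ℝ → Z → Z} {x₀ y₀ : Z} {a b : ℝ}

theorem IsSolutionOnIcc.triangular_fst {z : ℝ → Z × Z}
    (hz : IsSolutionOnIcc (triangular f F h) (x₀, y₀) a b z) :
    IsSolutionOnIcc f x₀ a b fun t => (z t).1 := by
  refine ⟨continuous_fst.comp_continuousOn hz.1, fun t ht => ?_⟩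
  obtain ⟨hi, he⟩ := hz.2 t ht
  refine ⟨⟨hi.1.fst, hi.2.fst⟩, ?_⟩
  have := congrArg (ContinuousLinearMap.fst ℝ Z Z) he
  rw [map_add, ← ContinuousLinearMap.intervalIntegral_comp_comm _ hi] at this
  exact this

theorem IsSolutionOnIcc.triangular_snd {z : ℝ → Z × Z}
    (hz : IsSolutionOnIcc (triangular f F h) (x₀, y₀) a b z) :
    IsSolutionOnIcc (fun t y => F t (z t).1 y + h t (z t).1) y₀ a b fun t => (z t).2 := by
  refine ⟨continuous_snd.comp_continuousOn hz.1, fun t ht => ?_⟩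
  obtain ⟨hi, he⟩ := hz.2 t ht
  refine ⟨⟨hi.1.snd, hi.2.snd⟩, ?_⟩
  have := congrArg (ContinuousLinearMap.snd ℝ Z Z) he
  rw [map_add, ← ContinuousLinearMap.intervalIntegral_comp_comm _ hi] at this
  exact this

theorem isSolutionOnIcc_triangular {x y : ℝ → Z}
    (hx : IsSolutionOnIcc f x₀ a b x)
    (hy : IsSolutionOnIcc (fun t y => F t (x t) y + h t (x t)) y₀ a b y) :
    IsSolutionOnIcc (triangular f F h) (x₀, y₀) a b fun t => (x t, y t) := by
  refine ⟨hx.1.prodMk hy.1, fun t ht => ?_⟩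
  obtain ⟨hxi, hxe⟩ := hx.2 t ht
  obtain ⟨hyi, hye⟩ := hy.2 t ht
  have hi : IntervalIntegrable (fun s => triangular f F h s (x s, y s)) volume 0 t :=
    ⟨hxi.1.prodMk hyi.1, hxi.2.prodMk hyi.2⟩
  refine ⟨hi, Prod.ext ?_ ?_⟩
  · have := ContinuousLinearMap.intervalIntegral_comp_comm (ContinuousLinearMap.fst ℝ Z Z) hi
    exact hxe.trans (congrArg (x₀ + ·) this)
  · have := ContinuousLinearMap.intervalIntegral_comp_comm (ContinuousLinearMap.snd ℝ Z Z) hi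
    exact hye.trans (congrArg (y₀ + ·) this)

end Triangular

/-! ### Uniqueness for the base equation and the triangular system. -/

section Uniqueness

variable {Z : Type*} [NormedAddCommGroup Z] [NormedSpace ℝ Z] [MeasurableSpace Z]

theorem hasUniqueSolutions_of_mem_LC {f : ℝ → Z → Z} (hf : f ∈ LC Z Z) (z₀ : Z) :
    HasUniqueSolutions f z₀ := by
  intro a b ha hb z₁ z₂ h₁ h₂
  obtain ⟨l, hl, hlip⟩ := hf.2 (z₁ '' Icc a b ∪ z₂ '' Icc a b)
    ((isCompact_Icc.image_of_continuousOn h₁.1).union (isCompact_Icc.image_of_continuousOn h₂.1))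
  refine h₁.eqOn_of_lipschitz h₂ ha hb hl ?_
  filter_upwards [hlip] with s hs hst
  exact hs _ (Or.inl (mem_image_of_mem _ hst)) _ (Or.inr (mem_image_of_mem _ hst))

/-- Once the first components agree, the second equation is affine in `y`: the term `h` cancels in
differences, and an `m`-bound of `F` on the range of `x` is a Lipschitz coefficient. No regularity
of `F` in `x` is needed. -/
theorem hasUniqueSolutions_triangular [CompleteSpace Z] [MeasurableSpace (Z →L[ℝ] Z)]
    {f : ℝ → Z → Z} {F : ℝ → Z → (Z →L[ℝ] Z)} {h : ℝ → Z → Z} {x₀ y₀ : Z}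
    (hf : f ∈ LC Z Z) (hF : IsCarath F) :
    HasUniqueSolutions (triangular f F h) (x₀, y₀) := by
  intro a b ha hb z₁ z₂ h₁ h₂
  have hx : EqOn (fun t => (z₁ t).1) (fun t => (z₂ t).1) (Icc a b) :=
    hasUniqueSolutions_of_mem_LC hf x₀ ha hb h₁.triangular_fst h₂.triangular_fst
  obtain ⟨m, hm, hmb⟩ := hF.2 ((fun t => (z₁ t).1) '' Icc a b)
    (isCompact_Icc.image_of_continuousOn (continuous_fst.comp_continuousOn h₁.1))
  have h₂' : IsSolutionOnIcc (fun t y => F t (z₁ t).1 y + h t (z₁ t).1) y₀ a b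
      fun t => (z₂ t).2 := by
    have h3 := h₂.triangular_snd
    refine ⟨h3.1, fun t ht => ?_⟩
    obtain ⟨hi, he⟩ := h3.2 t ht
    have hsub : uIcc 0 t ⊆ Icc a b := uIcc_subset_Icc ⟨ha, hb⟩ ht
    refine ⟨hi.congr fun s hs => ?_, he.trans ?_⟩
    · simp only [show (z₂ s).1 = (z₁ s).1 from (hx (hsub (uIoc_subset_uIcc hs))).symm]
    · congr 1
      refine intervalIntegral.integral_congr fun s hs => ?_
      simp only [show (z₂ s).1 = (z₁ s).1 from (hx (hsub hs)).symm]
  have hy := h₁.triangular_snd.eqOn_of_lipschitz h₂' ha hb hm (by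
    filter_upwards [hmb] with s hs hst
    rw [add_sub_add_right_eq_sub, ← map_sub]
    exact (F s (z₁ s).1).le_of_opNorm_le (hs _ (mem_image_of_mem _ hst)) _)
  exact fun t ht => Prod.ext (hx ht) (hy ht)

end Uniqueness

/-! ### The nonexpansive projection onto a ball. -/

section Projection

variable {H : Type*} [NormedAddCommGroup H] [InnerProductSpace ℝ H]

open Classical in
/-- The metric projection onto the closed ball of radius `r` centred at `0`. -/
noncomputable def ballProj (r : ℝ) (x : H) : H := if ‖x‖ ≤ r then x else (r / ‖x‖) • x

theorem ballProj_of_norm_le {r : ℝ} {x : H} (h : ‖x‖ ≤ r) : ballProj r x = x := if_pos h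

theorem norm_ballProj_le {r : ℝ} (hr : 0 ≤ r) (x : H) : ‖ballProj r x‖ ≤ r := by
  unfold ballProj
  split_ifs with h
  · exact h
  · have hx : 0 < ‖x‖ := hr.trans_lt (not_le.1 h)
    rw [norm_smul, norm_div, norm_norm, div_mul_cancel₀ _ hx.ne', Real.norm_of_nonneg hr]

theorem inner_sub_ballProj_le {r : ℝ} (hr : 0 ≤ r) (x : H) {w : H} (hw : ‖w‖ ≤ r) :
    inner ℝ (x - ballProj r x) (w - ballProj r x) ≤ 0 := by
  unfold ballProj
  split_ifs with h
  · simp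
  · have hx : 0 < ‖x‖ := hr.trans_lt (not_le.1 h)
    have h1 : x - (r / ‖x‖) • x = (1 - r / ‖x‖) • x := by rw [sub_smul, one_smul]
    have h2 : 0 ≤ 1 - r / ‖x‖ := sub_nonneg.2 ((div_le_one hx).2 (not_le.1 h).le)
    rw [h1, real_inner_smul_left, inner_sub_right, real_inner_smul_right,
      real_inner_self_eq_norm_sq]
    refine mul_nonpos_of_nonneg_of_nonpos h2 ?_
    have h3 : r / ‖x‖ * ‖x‖ ^ 2 = ‖x‖ * r := by field_simp
    have h4 : inner ℝ x w ≤ ‖x‖ * r :=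
      (real_inner_le_norm x w).trans (mul_le_mul_of_nonneg_left hw hx.le)
    linarith

/-- Adding the variational inequalities at `x` and at `y` gives `‖πx - πy‖² ≤ ⟨x - y, πx - πy⟩`;
Cauchy–Schwarz finishes. -/
theorem norm_ballProj_sub_le {r : ℝ} (hr : 0 ≤ r) (x y : H) :
    ‖ballProj r x - ballProj r y‖ ≤ ‖x - y‖ := by
  have h1 := inner_sub_ballProj_le hr x (norm_ballProj_le hr y)
  have h2 := inner_sub_ballProj_le hr y (norm_ballProj_le hr x)
  have h3 : ‖ballProj r x - ballProj r y‖ ^ 2 ≤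
      inner ℝ (x - y) (ballProj r x - ballProj r y) := by
    rw [← real_inner_self_eq_norm_sq]
    simp only [inner_sub_left, inner_sub_right] at *
    linarith
  have h4 := h3.trans (real_inner_le_norm _ _)
  rcases (norm_nonneg (ballProj r x - ballProj r y)).eq_or_lt with h0 | h0
  · rw [← h0]; positivity
  · rw [sq] at h4
    exact le_of_mul_le_mul_right h4 h0

theorem continuous_ballProj {r : ℝ} (hr : 0 ≤ r) : Continuous (ballProj r : H → H) :=
  (LipschitzWith.of_dist_le_mul (K := 1) fun x y => by
    simpa [dist_eq_norm] using norm_ballProj_sub_le hr x y).continuous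

end Projection

/-! ### Equi-integrable families and weak convergence on rational intervals. -/

section EquiIntegrable

variable {ι Y Y' : Type*} [NormedAddCommGroup Y] [NormedAddCommGroup Y']

/-- A family of locally integrable functions whose integrals over short subintervals of `[a, b]`
are uniformly small. -/
def EquiIntegrable (a b : ℝ) (D : ι → ℝ → Y) : Prop :=
  (∀ i, LocallyIntegrable (D i) volume) ∧
    ∀ ε > 0, ∃ δ > 0, ∀ i, ∀ s ∈ Icc a b, ∀ t ∈ Icc a b, s ≤ t → t - s < δ →
      ∫ u in s..t, ‖D i u‖ ≤ ε

theorem intervalIntegrable_norm {m : ℝ → Y} (hm : LocallyIntegrable m volume) (s t : ℝ) :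
    IntervalIntegrable (fun u => ‖m u‖) volume s t :=
  (intervalIntegrable_of_locallyIntegrable hm s t).norm

theorem L1locEquicontinuous.equiIntegrable {S : Set (ℝ → ℝ)} (hS : L1locEquicontinuous S)
    (a b : ℝ) {μ : ι → ℝ → ℝ} (hμ : ∀ i, μ i ∈ S) : EquiIntegrable a b μ := by
  refine ⟨fun i => (hS.1 _ (hμ i)).1, fun ε hε => ?_⟩
  obtain ⟨δ, hδ, h⟩ := hS.2 (|a| + |b| + 1) (by positivity) ε hε
  refine ⟨δ, hδ, fun i s hs t ht hst hd => ?_⟩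
  have h1 := h s t (by linarith [neg_abs_le a, abs_nonneg b, hs.1]) hst
    (by linarith [le_abs_self b, abs_nonneg a, ht.2]) hd (μ i) (hμ i)
  refine le_trans (le_of_eq ?_) h1.le
  exact intervalIntegral.integral_congr fun u _ =>
    Real.norm_of_nonneg ((hS.1 _ (hμ i)).2 u)

theorem equiIntegrable_const {m : ℝ → Y} (hm : LocallyIntegrable m volume) (a b : ℝ) :
    EquiIntegrable a b fun _ : ι => m := by
  refine ⟨fun _ => hm, fun ε hε => ?_⟩
  have hc : Continuous fun t : ℝ => ∫ u in (0 : ℝ)..t, ‖m u‖ :=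
    intervalIntegral.continuous_primitive (intervalIntegrable_norm hm) 0
  have huc := isCompact_Icc.uniformContinuousOn_of_continuous (hc.continuousOn (s := Icc a b))
  obtain ⟨δ, hδ, h⟩ := Metric.uniformContinuousOn_iff.1 huc ε hε
  refine ⟨δ, hδ, fun _ s hs t ht hst hd => ?_⟩
  have h1 := h t ht s hs (by rwa [Real.dist_eq, abs_of_nonneg (sub_nonneg.2 hst)])
  rw [Real.dist_eq, intervalIntegral.integral_interval_sub_left (intervalIntegrable_norm hm _ _)
    (intervalIntegrable_norm hm _ _)] at h1
  exact (le_abs_self _).trans h1.le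

theorem locallyIntegrable_norm {m : ℝ → Y} (hm : LocallyIntegrable m volume) :
    LocallyIntegrable (fun u => ‖m u‖) volume :=
  hm.mono hm.aestronglyMeasurable.norm (Eventually.of_forall fun u => by simp)

theorem EquiIntegrable.norm {a b : ℝ} {D : ι → ℝ → Y} (hD : EquiIntegrable a b D) :
    EquiIntegrable a b fun i u => ‖D i u‖ :=
  ⟨fun i => locallyIntegrable_norm (hD.1 i), by simpa only [norm_norm] using hD.2⟩

theorem EquiIntegrable.of_norm_le_add {a b : ℝ} {D : ι → ℝ → Y} {μ ν : ι → ℝ → ℝ}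
    (hμ : EquiIntegrable a b μ) (hν : EquiIntegrable a b ν)
    (hD : ∀ i, LocallyIntegrable (D i) volume) (h : ∀ i, ∀ᵐ u, ‖D i u‖ ≤ μ i u + ν i u) :
    EquiIntegrable a b D := by
  refine ⟨hD, fun ε hε => ?_⟩
  obtain ⟨δ₁, hδ₁, h₁⟩ := hμ.2 (ε / 2) (half_pos hε)
  obtain ⟨δ₂, hδ₂, h₂⟩ := hν.2 (ε / 2) (half_pos hε)
  refine ⟨min δ₁ δ₂, lt_min hδ₁ hδ₂, fun i s hs t ht hst hd => ?_⟩
  have e₁ := h₁ i s hs t ht hst (hd.trans_le (min_le_left _ _))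
  have e₂ := h₂ i s hs t ht hst (hd.trans_le (min_le_right _ _))
  have i₁ := intervalIntegrable_norm (hμ.1 i) s t
  have i₂ := intervalIntegrable_norm (hν.1 i) s t
  calc ∫ u in s..t, ‖D i u‖ ≤ ∫ u in s..t, (‖μ i u‖ + ‖ν i u‖) := by
        refine intervalIntegral.integral_mono_ae hst (intervalIntegrable_norm (hD i) s t)
          (i₁.add i₂) ?_
        filter_upwards [h i] with u hu
        exact hu.trans (add_le_add (le_abs_self _) (le_abs_self _))
    _ = (∫ u in s..t, ‖μ i u‖) + ∫ u in s..t, ‖ν i u‖ := intervalIntegral.integral_add i₁ i₂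
    _ ≤ ε := by linarith

/-- Cut `[a, b]` into `K` pieces shorter than the `δ` belonging to `ε = 1`; each contributes at most
`1`, so `M = K`. -/
theorem EquiIntegrable.exists_integral_norm_le {a b : ℝ} (hab : a ≤ b) {D : ι → ℝ → Y}
    (hD : EquiIntegrable a b D) : ∃ M, ∀ i, ∫ u in a..b, ‖D i u‖ ≤ M := by
  obtain ⟨δ, hδ, h⟩ := hD.2 1 one_pos
  obtain ⟨K, hK⟩ := exists_nat_gt ((b - a) / δ)
  have hK0 : (0 : ℝ) < K := (div_nonneg (sub_nonneg.2 hab) hδ.le).trans_lt hK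
  set c := (b - a) / K with hc
  have hc0 : 0 ≤ c := div_nonneg (sub_nonneg.2 hab) hK0.le
  have hcδ : c < δ := by
    rw [hc, div_lt_iff₀ hK0]
    rwa [div_lt_iff₀ hδ, mul_comm] at hK
  have hKc : K * c = b - a := mul_div_cancel₀ _ hK0.ne'
  have hmem : ∀ k : ℕ, k ≤ K → a + k * c ∈ Icc a b := by
    intro k hk
    have h1 : (k : ℝ) * c ≤ K * c := by gcongr
    have h2 : 0 ≤ (k : ℝ) * c := by positivity
    constructor <;> linarith
  refine ⟨K, fun i => ?_⟩
  have hsum := intervalIntegral.sum_integral_adjacent_intervals (μ := volume)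
    (f := fun u => ‖D i u‖) (a := fun k : ℕ => a + k * c) (n := K)
    fun k _ => intervalIntegrable_norm (hD.1 i) _ _
  rw [Nat.cast_zero, zero_mul, add_zero, hKc, add_sub_cancel] at hsum
  rw [← hsum]
  calc _ ≤ ∑ k ∈ Finset.range K, (1 : ℝ) := by
        refine Finset.sum_le_sum fun k hk => ?_
        have hk' := Finset.mem_range.1 hk
        refine h i _ (hmem k hk'.le) _ (hmem (k + 1) hk') ?_ ?_
        · push_cast; linarith
        · push_cast; linarith
    _ = K := by simp

variable [NormedSpace ℝ Y] [NormedSpace ℝ Y']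

theorem integral_Icc_eq_intervalIntegral {D : ℝ → Y} {s t : ℝ} (h : s ≤ t) :
    ∫ u in Icc s t, D u = ∫ u in s..t, D u := by
  rw [integral_Icc_eq_integral_Ioc, intervalIntegral.integral_of_le h]

/-- If the integrals of an equi-integrable sequence over rational intervals tend to `0`, then so do
its primitives, uniformly. -/
theorem EquiIntegrable.eventually_norm_integral_le {a b : ℚ} (ha : (a : ℝ) < 0) (hb : (0 : ℝ) < b)
    {D : ℕ → ℝ → Y} (hD : EquiIntegrable (a : ℝ) b D)
    (hlim : ∀ q₁ q₂ : ℚ, a ≤ q₁ → q₁ < q₂ → q₂ ≤ b →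
      Tendsto (fun n => ∫ u in Icc (q₁ : ℝ) q₂, D n u) atTop (𝓝 0)) {ε : ℝ} (hε : 0 < ε) :
    ∀ᶠ n in atTop, ∀ t ∈ Icc (a : ℝ) b, ‖∫ u in (0 : ℝ)..t, D n u‖ ≤ ε := by
  have haQ : a < 0 := by exact_mod_cast ha
  have hbQ : 0 < b := by exact_mod_cast hb
  have hq : ∀ q : ℚ, a ≤ q → q ≤ b →
      Tendsto (fun n => ∫ u in (0 : ℝ)..q, D n u) atTop (𝓝 0) := by
    intro q h1 h2
    rcases lt_trichotomy q 0 with h | h | h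
    · have h3 := (hlim q 0 h1 h hbQ.le).neg
      rw [neg_zero] at h3
      refine h3.congr fun n => ?_
      rw [integral_Icc_eq_intervalIntegral (by exact_mod_cast h.le), Rat.cast_zero,
        intervalIntegral.integral_symm, neg_neg]
    · simp [h]
    · refine (hlim 0 q haQ.le h h2).congr fun n => ?_
      rw [integral_Icc_eq_intervalIntegral (by exact_mod_cast h.le), Rat.cast_zero]
  -- On a finite rational grid of mesh below `δ` the primitives are eventually at most `ε / 2`; from
  -- any `t` to the grid point on its left, equi-integrability costs another `ε / 2`.
  obtain ⟨δ, hδ, h⟩ := hD.2 (ε / 2) (half_pos hε)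
  obtain ⟨K, hK⟩ := exists_nat_gt (((b : ℝ) - a) / δ)
  have hab : (0 : ℝ) < b - a := by linarith
  have hK0 : (0 : ℝ) < K := (div_nonneg hab.le hδ.le).trans_lt hK
  set c : ℚ := (b - a) / K with hc
  have hcR : (c : ℝ) = ((b : ℝ) - a) / K := by rw [hc]; push_cast; rfl
  have hc0 : (0 : ℝ) < c := by rw [hcR]; positivity
  have hcδ : (c : ℝ) < δ := by
    rw [hcR, div_lt_iff₀ hK0]
    rwa [div_lt_iff₀ hδ, mul_comm] at hK
  have hKc : K * (c : ℝ) = b - a := by rw [hcR]; exact mul_div_cancel₀ _ hK0.ne'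
  have hmem : ∀ k : ℕ, k ≤ K → ((a + k * c : ℚ) : ℝ) ∈ Icc (a : ℝ) b := by
    intro k hk
    have h1 : (k : ℝ) * c ≤ K * c := by gcongr
    have h2 : 0 ≤ (k : ℝ) * c := by positivity
    push_cast
    constructor <;> linarith
  have hev : ∀ᶠ n in atTop, ∀ k ∈ Finset.range (K + 1),
      ‖∫ u in (0 : ℝ)..((a + k * c : ℚ) : ℝ), D n u‖ ≤ ε / 2 := by
    refine (Finset.eventually_all _).2 fun k hk => ?_
    have hk' := hmem k (Nat.lt_succ_iff.1 (Finset.mem_range.1 hk))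
    have h1 := hq (a + k * c) (by exact_mod_cast hk'.1) (by exact_mod_cast hk'.2)
    have h2 := h1.norm
    rw [norm_zero] at h2
    exact (h2.eventually_lt_const (half_pos hε)).mono fun _ h => h.le
  filter_upwards [hev] with n hn t ht
  have hx0 : 0 ≤ (t - a) / c := div_nonneg (sub_nonneg.2 ht.1) hc0.le
  have hfl := Nat.floor_le hx0
  have hfl2 := Nat.lt_floor_add_one ((t - a) / c)
  set k := ⌊(t - a) / (c : ℝ)⌋₊ with hk
  rw [le_div_iff₀ hc0] at hfl
  rw [div_lt_iff₀ hc0] at hfl2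
  have hkK : k ≤ K := by
    have : (k : ℝ) * c ≤ K * c := by linarith [ht.2]
    exact_mod_cast le_of_mul_le_mul_right this hc0
  have hkm := hmem k hkK
  have hp : ((a + k * c : ℚ) : ℝ) = a + k * c := by push_cast; rfl
  have h1 := hn k (Finset.mem_range.2 (Nat.lt_succ_iff.2 hkK))
  have hst : ((a + k * c : ℚ) : ℝ) ≤ t := by rw [hp]; linarith
  have h2 := h n _ hkm t ht hst (by rw [hp]; linarith)
  have h3 := intervalIntegral.norm_integral_le_integral_norm (f := D n) (μ := volume) hst
  rw [← intervalIntegral.integral_add_adjacent_intervals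
    (intervalIntegrable_of_locallyIntegrable (hD.1 n) 0 ((a + k * c : ℚ) : ℝ))
    (intervalIntegrable_of_locallyIntegrable (hD.1 n) _ t)]
  refine (norm_add_le _ _).trans ?_
  linarith

theorem locallyIntegrable_clm_apply {D : ℝ → (Y →L[ℝ] Y')} (hD : LocallyIntegrable D volume)
    {y : ℝ → Y} (hy : Continuous y) : LocallyIntegrable (fun u => D u (y u)) volume := by
  have hm : LocallyIntegrable (fun u => ‖D u‖ * ‖y u‖) volume :=
    locallyIntegrable_mul_continuous (locallyIntegrable_norm hD) hy.norm
  refine hm.mono ?_ (Eventually.of_forall fun u => ?_)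
  · exact isBoundedBilinearMap_apply.continuous.comp_aestronglyMeasurable
      (hD.aestronglyMeasurable.prodMk hy.aestronglyMeasurable)
  · rw [Real.norm_of_nonneg (by positivity)]
    exact (D u).le_opNorm _

theorem EquiIntegrable.clm_apply {a b : ℝ} {D : ι → ℝ → (Y →L[ℝ] Y')} (hD : EquiIntegrable a b D)
    {y : ℝ → Y} (hy : Continuous y) : EquiIntegrable a b fun i u => D i u (y u) := by
  refine ⟨fun i => locallyIntegrable_clm_apply (hD.1 i) hy, fun ε hε => ?_⟩
  obtain ⟨C, hC⟩ := isCompact_Icc.exists_bound_of_continuousOn (hy.continuousOn (s := Icc a b))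
  obtain ⟨δ, hδ, h⟩ := hD.2 (ε / (|C| + 1)) (by positivity)
  refine ⟨δ, hδ, fun i s hs t ht hst hd => ?_⟩
  calc ∫ u in s..t, ‖D i u (y u)‖ ≤ ∫ u in s..t, ‖D i u‖ * (|C| + 1) := by
        refine intervalIntegral.integral_mono_on hst
          (intervalIntegrable_norm (locallyIntegrable_clm_apply (hD.1 i) hy) s t)
          ((intervalIntegrable_norm (hD.1 i) s t).mul_const _) fun u hu => ?_
        refine (D i u).le_opNorm_of_le ?_
        linarith [hC u ⟨hs.1.trans hu.1, hu.2.trans ht.2⟩, le_abs_self C]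
    _ = (∫ u in s..t, ‖D i u‖) * (|C| + 1) := intervalIntegral.integral_mul_const _ _
    _ ≤ ε / (|C| + 1) * (|C| + 1) := by
        have := h i s hs t ht hst hd
        gcongr
    _ = ε := by field_simp

/-- Weak convergence to `0` of the coefficients is preserved by a continuous multiplier. -/
theorem EquiIntegrable.tendsto_integral_clm_apply [CompleteSpace Y'] {a b : ℚ}
    {D : ℕ → ℝ → (Y →L[ℝ] Y')}
    (hD : EquiIntegrable (a : ℝ) b D)
    (hlim : ∀ q₁ q₂ : ℚ, a ≤ q₁ → q₁ < q₂ → q₂ ≤ b →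
      Tendsto (fun n => ∫ u in Icc (q₁ : ℝ) q₂, D n u) atTop (𝓝 0))
    {y : ℝ → Y} (hy : Continuous y) {q₁ q₂ : ℚ} (h₁ : a ≤ q₁) (h₁₂ : q₁ < q₂) (h₂ : q₂ ≤ b) :
    Tendsto (fun n => ∫ u in Icc (q₁ : ℝ) q₂, D n u (y u)) atTop (𝓝 0) := by
  have h₁R : (a : ℝ) ≤ q₁ := by exact_mod_cast h₁
  have h₂R : (q₂ : ℝ) ≤ b := by exact_mod_cast h₂
  have h₁₂R : (0 : ℝ) < q₂ - q₁ := sub_pos.2 (by exact_mod_cast h₁₂)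
  obtain ⟨M, hM⟩ := EquiIntegrable.exists_integral_norm_le (a := (q₁ : ℝ)) (b := q₂)
    (by linarith) (D := D) ⟨hD.1, fun ε hε => by
      obtain ⟨δ, hδ, h⟩ := hD.2 ε hε
      exact ⟨δ, hδ, fun i s hs t ht => h i s ⟨h₁R.trans hs.1, hs.2.trans h₂R⟩ t
        ⟨h₁R.trans ht.1, ht.2.trans h₂R⟩⟩⟩
  rw [NormedAddGroup.tendsto_nhds_zero]
  intro ε hε
  have hη : 0 < ε / 2 / (|M| + 1) := by positivity
  -- Freezing `y` at the left end of each grid cell costs at most `η` times the uniform `L¹` bound,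
  -- that is `ε / 2`; the frozen sum is finite and tends to zero by `hlim`.
  set η := ε / 2 / (|M| + 1) with hηdef
  obtain ⟨δ, hδ, huc⟩ := Metric.uniformContinuousOn_iff.1
    (isCompact_Icc.uniformContinuousOn_of_continuous
      (hy.continuousOn (s := Icc (q₁ : ℝ) q₂))) η hη
  obtain ⟨K, hK⟩ := exists_nat_gt (((q₂ : ℝ) - q₁) / δ)
  have hK0 : (0 : ℝ) < K := (div_nonneg h₁₂R.le hδ.le).trans_lt hK
  set c : ℚ := (q₂ - q₁) / K with hc
  have hcR : (c : ℝ) = ((q₂ : ℝ) - q₁) / K := by rw [hc]; push_cast; rfl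
  have hc0 : (0 : ℝ) < c := by rw [hcR]; positivity
  have hc0Q : 0 < c := by exact_mod_cast hc0
  have hcδ : (c : ℝ) < δ := by
    rw [hcR, div_lt_iff₀ hK0]
    rwa [div_lt_iff₀ hδ, mul_comm] at hK
  have hKc : K * (c : ℝ) = q₂ - q₁ := by rw [hcR]; exact mul_div_cancel₀ _ hK0.ne'
  set p : ℕ → ℚ := fun k => q₁ + k * c with hp
  have hpR : ∀ k, (p k : ℝ) = q₁ + k * c := fun k => by simp [hp]
  have hpK : (p K : ℝ) = q₂ := by rw [hpR, hKc]; ring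
  have hp0 : (p 0 : ℝ) = q₁ := by simp [hp]
  have hmem : ∀ k : ℕ, k ≤ K → (p k : ℝ) ∈ Icc (q₁ : ℝ) q₂ := by
    intro k hk
    have h1 : (k : ℝ) * c ≤ K * c := by gcongr
    have h2 : 0 ≤ (k : ℝ) * c := by positivity
    rw [hpR]
    constructor <;> linarith
  have hstep : ∀ k, p k < p (k + 1) := fun k => by
    simp only [hp]; push_cast; linarith
  have hstepR : ∀ k, (p k : ℝ) < p (k + 1) := fun k => by exact_mod_cast hstep k
  have hsmall : ∀ᶠ n in atTop,
      ‖∑ k ∈ Finset.range K, (∫ u in (p k : ℝ)..p (k + 1), D n u) (y (p k))‖ < ε / 2 := by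
    have h0 : Tendsto (fun n => ∑ k ∈ Finset.range K,
        (∫ u in (p k : ℝ)..p (k + 1), D n u) (y (p k))) atTop (𝓝 0) := by
      rw [← Finset.sum_const_zero (s := Finset.range K)]
      refine tendsto_finsetSum _ fun k hk => ?_
      have hk' := Finset.mem_range.1 hk
      have hl := hlim (p k) (p (k + 1))
        (by exact_mod_cast h₁R.trans (hmem k hk'.le).1) (hstep k)
        (by exact_mod_cast (hmem (k + 1) hk').2.trans h₂R)
      simp_rw [integral_Icc_eq_intervalIntegral (hstepR k).le] at hl
      simpa [Function.comp_def] using ((ContinuousLinearMap.apply ℝ Y' (y (p k))).continuous.tendsto 0).comp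
        hl
    exact (NormedAddGroup.tendsto_nhds_zero.1 h0) _ (half_pos hε)
  filter_upwards [hsmall] with n hn
  have hDi := fun s t => intervalIntegrable_of_locallyIntegrable (hD.1 n) s t
  have hDy := fun s t =>
    intervalIntegrable_of_locallyIntegrable (locallyIntegrable_clm_apply (hD.1 n) hy) s t
  have hDc := fun (k : ℕ) s t => intervalIntegrable_of_locallyIntegrable
    (locallyIntegrable_clm_apply (hD.1 n) (continuous_const (y := y (p k)))) s t
  have hs1 := intervalIntegral.sum_integral_adjacent_intervals (μ := volume)
    (f := fun u => D n u (y u)) (a := fun k : ℕ => (p k : ℝ)) (n := K) fun k _ => hDy _ _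
  have hs2 := intervalIntegral.sum_integral_adjacent_intervals (μ := volume)
    (f := fun u => ‖D n u‖) (a := fun k : ℕ => (p k : ℝ)) (n := K)
    fun k _ => intervalIntegrable_norm (hD.1 n) _ _
  rw [hp0, hpK] at hs1 hs2
  have hdiff : ‖(∑ k ∈ Finset.range K, ∫ u in (p k : ℝ)..p (k + 1), D n u (y u)) -
      ∑ k ∈ Finset.range K, (∫ u in (p k : ℝ)..p (k + 1), D n u) (y (p k))‖ ≤ ε / 2 := by
    rw [← Finset.sum_sub_distrib]
    calc _ ≤ ∑ k ∈ Finset.range K, η * ∫ u in (p k : ℝ)..p (k + 1), ‖D n u‖ := by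
          refine norm_sum_le_of_le _ fun k hk => ?_
          have hk' := Finset.mem_range.1 hk
          rw [ContinuousLinearMap.intervalIntegral_apply (hDi _ _),
            ← intervalIntegral.integral_sub (hDy _ _) (hDc k _ _),
            ← intervalIntegral.integral_const_mul]
          refine intervalIntegral.norm_integral_le_of_norm_le (hstepR k).le
            (Eventually.of_forall fun u hu => ?_) ((intervalIntegrable_norm (hD.1 n) _ _).const_mul _)
          rw [← map_sub, mul_comm]
          refine (D n u).le_opNorm_of_le ?_
          have hu' : u ∈ Icc (q₁ : ℝ) q₂ :=
            ⟨(hmem k hk'.le).1.trans hu.1.le, hu.2.trans (hmem (k + 1) hk').2⟩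
          have hd : dist u (p k : ℝ) < δ := by
            rw [Real.dist_eq, abs_of_pos (sub_pos.2 hu.1)]
            have h3 := hu.2
            rw [hpR] at h3 ⊢
            push_cast at h3
            linarith
          rw [← dist_eq_norm]
          exact (huc u hu' _ (hmem k hk'.le) hd).le
      _ = η * ∫ u in (q₁ : ℝ)..q₂, ‖D n u‖ := by rw [← Finset.mul_sum, hs2]
      _ ≤ η * (|M| + 1) := by
          gcongr
          linarith [hM n, le_abs_self M]
      _ = ε / 2 := by rw [hηdef]; field_simp
  rw [integral_Icc_eq_intervalIntegral (by linarith), ← hs1]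
  have := norm_sub_norm_le (∑ k ∈ Finset.range K, ∫ u in (p k : ℝ)..p (k + 1), D n u (y u))
    (∑ k ∈ Finset.range K, (∫ u in (p k : ℝ)..p (k + 1), D n u) (y (p k)))
  linarith

end EquiIntegrable

/-- The uniform bound `M` makes the Grönwall factor `2 exp (4M + 1)` independent of `n`, so small
data give small `u n`. -/
theorem eventually_le_of_gronwall {a b M : ℝ} (ha : a ≤ 0) (hb : 0 ≤ b) {l u : ℕ → ℝ → ℝ}
    (hl : ∀ n, LocallyIntegrable (l n) volume) (hM : ∀ n, ∫ s in Icc a b, |l n s| ≤ M)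
    (hu : ∀ n, ContinuousOn (u n) (Icc a b)) (hu0 : ∀ n, ∀ t ∈ Icc a b, 0 ≤ u n t)
    (h : ∀ ε > 0, ∀ᶠ n in atTop, ∀ t ∈ Icc a b,
      u n t ≤ ε + |∫ s in (0 : ℝ)..t, |l n s| * u n s|) {η : ℝ} (hη : 0 < η) :
    ∀ᶠ n in atTop, ∀ t ∈ Icc a b, u n t ≤ η := by
  filter_upwards [h (η / (2 * Real.exp (4 * M + 1))) (by positivity)] with n hn t ht
  refine (gronwall_le (hl n) ha hb (hu n) (hu0 n) (by positivity) hn t ht).trans ?_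
  calc _ ≤ 2 * (η / (2 * Real.exp (4 * M + 1))) * Real.exp (4 * M + 1) := by
        have := hM n
        gcongr
    _ = η := by field_simp

/-! ### Optimal bounds, the sets `K_j^I` and the seminorms. -/

section Spaces

variable {X Y : Type*} [NormedAddCommGroup X] [NormedAddCommGroup Y]

theorem IsMBound.ae_norm_comp_le {g : ℝ → X → Y} {r : ℝ} {m : ℝ → ℝ}
    (hm : IsMBound g (Metric.closedBall 0 r) m) {z : ℝ → X} (hz : ∀ s, ‖z s‖ ≤ r) :
    ∀ᵐ s, ‖g s (z s)‖ ≤ m s := by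
  filter_upwards [hm.2] with s hs
  exact hs _ (mem_closedBall_zero_iff.2 (hz s))

theorem optMBound_nonneg (f : ℝ → X → Y) (j : ℕ) (t : ℝ) : 0 ≤ optMBound f j t :=
  Real.iSup_nonneg fun _ => norm_nonneg _

theorem IsMBound.optMBound_le {f : ℝ → X → Y} {j : ℕ} {m : ℝ → ℝ}
    (hm : IsMBound f (Metric.closedBall 0 (j : ℝ)) m) : ∀ᵐ t, optMBound f j t ≤ m t := by
  have : Nonempty (Metric.closedBall (0 : X) (j : ℝ)) := ⟨⟨0, by simp⟩⟩
  filter_upwards [hm.2] with t ht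
  exact ciSup_le fun x => ht x x.2

/-- The limit field need not belong to `E`, so its solution is placed in `K_j^I` only as a limit of
curves lying there; `WTC` requires this membership. -/
theorem mem_modSet_of_tendsto {Θ : ModFamily} {j : ℕ} {q₁ q₂ : ℚ} {xn : ℕ → ℝ → X} {x : ℝ → X}
    (hx : ContinuousOn x (Icc (q₁ : ℝ) q₂)) (hxn : ∀ n, xn n ∈ modSet X Θ j q₁ q₂)
    (hlim : ∀ t ∈ Icc (q₁ : ℝ) q₂, Tendsto (fun n => xn n t) atTop (𝓝 (x t))) :
    x ∈ modSet X Θ j q₁ q₂ :=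
  ⟨hx, fun t ht => le_of_tendsto (hlim t ht).norm (Eventually.of_forall fun n => (hxn n).2.1 t ht),
    fun s hs t ht => le_of_tendsto ((hlim s hs).sub (hlim t ht)).norm
      (Eventually.of_forall fun n => (hxn n).2.2 s hs t ht)⟩

theorem eventually_sigmaSeminorm_lt [NormedSpace ℝ Y] {Θ : ModFamily}
    {S : Set (ℝ → X → Y)} {fn : ℕ → S} {f : S}
    (h : Tendsto fn atTop (@nhds _ (sigmaTopology Θ S) f)) (j : ℕ) {q₁ q₂ : ℚ} (hq : q₁ < q₂)
    {ε : ℝ} (hε : 0 < ε) :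
    ∀ᶠ n in atTop, sigmaSeminorm Θ j q₁ q₂ (fun t x => (fn n).1 t x - f.1 t x) < ε := by
  let _ := sigmaTopology Θ S
  have hopen : IsOpen {g : S | sigmaSeminorm Θ j q₁ q₂ (fun t x => g.1 t x - f.1 t x) < ε} :=
    TopologicalSpace.isOpen_generateFrom_of_mem ⟨f, j, q₁, q₂, ε, hq, hε, rfl⟩
  refine h (hopen.mem_nhds ?_)
  simpa [sigmaSeminorm] using hε

variable [MeasurableSpace X] [MeasurableSpace Y]

theorem IsCarath.measurable_comp [BorelSpace X] {g : ℝ → X → Y} (hg : IsCarath g) {z : ℝ → X}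
    (hz : Continuous z) : Measurable fun s => g s (z s) :=
  hg.1.comp (measurable_id.prodMk hz.measurable)

theorem IsCarath.exists_mBound_closedBall [ProperSpace X] {g : ℝ → X → Y} (hg : IsCarath g) (r : ℝ) :
    ∃ m, IsMBound g (Metric.closedBall 0 r) m :=
  hg.2 _ (isCompact_closedBall 0 r)

theorem ae_norm_le_optMBound [ProperSpace X] {f : ℝ → X → Y} (hf : IsCarath f) (j : ℕ) :
    ∀ᵐ t, ∀ x ∈ Metric.closedBall (0 : X) (j : ℝ), ‖f t x‖ ≤ optMBound f j t := by
  obtain ⟨m, hm⟩ := hf.exists_mBound_closedBall (j : ℝ)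
  filter_upwards [hm.2] with t ht x hx
  have hbdd : BddAbove (range fun x : Metric.closedBall (0 : X) (j : ℝ) => ‖f t x‖) :=
    ⟨m t, by rintro _ ⟨x, rfl⟩; exact ht x x.2⟩
  exact le_ciSup hbdd (⟨x, hx⟩ : Metric.closedBall (0 : X) (j : ℝ))

/-- The Lipschitz bound makes `f t` continuous on `B_j` for a.e. `t`, so the uncountable supremum
equals one over a countable dense set. -/
theorem aemeasurable_optMBound [ProperSpace X] [BorelSpace Y] {f : ℝ → X → Y}
    (hf : f ∈ LC X Y) (j : ℕ) :
    AEMeasurable (optMBound f j) volume := by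
  obtain ⟨S, hSc, hSd⟩ :=
    TopologicalSpace.exists_countable_dense (Metric.closedBall (0 : X) (j : ℝ))
  have : Countable S := hSc
  obtain ⟨l, -, hl⟩ := hf.2 _ (isCompact_closedBall (0 : X) (j : ℝ))
  refine ⟨fun t => ⨆ x : S, ‖f t x.1.1‖, Measurable.iSup fun x => ?_, ?_⟩
  · exact (hf.1.1.comp (measurable_id.prodMk measurable_const)).norm
  · filter_upwards [hl] with t ht
    have hc : Continuous fun x : Metric.closedBall (0 : X) (j : ℝ) => f t x :=
      (LipschitzWith.of_dist_le_mul (K := (l t).toNNReal) fun x y => by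
        rw [dist_eq_norm, Subtype.dist_eq, dist_eq_norm]
        refine (ht x x.2 y y.2).trans ?_
        gcongr
        exact Real.le_coe_toNNReal _).continuous
    exact (hSd.ciSup' hc.norm).symm

theorem locallyIntegrable_optMBound [ProperSpace X] [BorelSpace Y] {f : ℝ → X → Y}
    (hf : f ∈ LC X Y) (j : ℕ) :
    LocallyIntegrable (optMBound f j) volume := by
  obtain ⟨m, hm⟩ := hf.1.exists_mBound_closedBall (j : ℝ)
  refine locallyIntegrable_of_norm_le (aemeasurable_optMBound hf j).aestronglyMeasurable hm.1 ?_
  filter_upwards [hm.optMBound_le] with t ht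
  rwa [Real.norm_of_nonneg (optMBound_nonneg f j t)]

/-- The real supremum of an unbounded family is `0` by convention, so boundedness must be checked;
the `m`-bounds on `B_j` supply it. -/
theorem norm_integral_sub_le_sigmaSeminorm [NormedSpace ℝ Y] [ProperSpace X] {Θ : ModFamily} {j : ℕ}
    {q₁ q₂ : ℚ} {g g' : ℝ → X → Y}
    (hg : IsCarath g) (hg' : IsCarath g') {z : ℝ → X} (hz : z ∈ modSet X Θ j q₁ q₂) :
    ‖∫ t in Icc (q₁ : ℝ) q₂, (g t (z t) - g' t (z t))‖ ≤
      sigmaSeminorm Θ j q₁ q₂ fun t x => g t x - g' t x := by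
  obtain ⟨m, hm⟩ := hg.exists_mBound_closedBall (j : ℝ)
  obtain ⟨m', hm'⟩ := hg'.exists_mBound_closedBall (j : ℝ)
  refine le_ciSup (f := fun x : modSet X Θ j q₁ q₂ =>
    ‖∫ t in Icc (q₁ : ℝ) q₂, (g t (x.1 t) - g' t (x.1 t))‖)
    ⟨∫ t in Icc (q₁ : ℝ) q₂, (m t + m' t), ?_⟩ ⟨z, hz⟩
  rintro _ ⟨x, rfl⟩
  refine norm_integral_le_of_norm_le
    ((hm.1.add hm'.1).integrableOn_isCompact isCompact_Icc) ?_
  refine (ae_restrict_iff' measurableSet_Icc).2 ?_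
  filter_upwards [hm.2, hm'.2] with t ht ht' hti
  have hb : x.1 t ∈ Metric.closedBall (0 : X) (j : ℝ) :=
    mem_closedBall_zero_iff.2 (x.2.2.1 t hti)
  exact (norm_sub_le _ _).trans (add_le_add (ht _ hb) (ht' _ hb))

theorem integral_optMBound_le_thetaOf [ProperSpace X] [BorelSpace Y] {E : Set (ℝ → X → Y)}
    (hE : E ⊆ LC X Y) (hEm : HasEquicontinuousMBounds E) {f : ℝ → X → Y} (hf : f ∈ E) (j : ℕ) {q₁ q₂ : ℚ} {s t : ℝ}
    (hs : s ∈ Icc (q₁ : ℝ) q₂) (ht : t ∈ Icc (q₁ : ℝ) q₂) (hst : s ≤ t) :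
    ∫ u in s..t, optMBound f j u ≤ thetaOf E j q₁ q₂ (t - s) := by
  have hq : (q₁ : ℝ) ≤ q₂ := hs.1.trans hs.2
  refine le_csSup ?_ ⟨s, hs, f, hf, by rw [add_sub_cancel]⟩
  obtain ⟨S, hS, hSE⟩ := hEm j
  -- Boundedness of the set behind `thetaOf` comes from the equicontinuous `m`-bounds. The interval
  -- is doubled because `τ + (t - s)` may exceed `q₂`.
  obtain ⟨M, hM⟩ := (hS.equiIntegrable (q₁ : ℝ) (q₂ + (q₂ - q₁))
    (μ := fun m : S => m.1) fun m => m.2).exists_integral_norm_le (by linarith)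
  refine ⟨M, ?_⟩
  rintro _ ⟨τ, hτ, g, hg, rfl⟩
  obtain ⟨m, hmS, hm⟩ := hSE g hg
  have h0 : τ ≤ τ + (t - s) := by linarith
  have hmi := intervalIntegrable_norm hm.1
  calc ∫ u in τ..(τ + (t - s)), optMBound g j u ≤ ∫ u in τ..(τ + (t - s)), ‖m u‖ := by
        refine intervalIntegral.integral_mono_ae h0 (intervalIntegrable_of_locallyIntegrable
          (locallyIntegrable_optMBound (hE hg) j) _ _) (hmi _ _) ?_
        filter_upwards [hm.optMBound_le] with u hu using hu.trans (le_abs_self _)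
    _ ≤ ∫ u in (q₁ : ℝ)..(q₂ + (q₂ - q₁)), ‖m u‖ :=
        intervalIntegral.integral_mono_interval hτ.1 h0
          (by linarith [hτ.2, hs.1, ht.2]) (Eventually.of_forall fun u => norm_nonneg _) (hmi _ _)
    _ ≤ M := hM ⟨m, hmS⟩

theorem tendsto_integral_sub_of_tendsto [NormedSpace ℝ Y] [ProperSpace X] {Θ : ModFamily}
    {S : Set (ℝ → X → Y)} (hS : ∀ g ∈ S, IsCarath g) {fn : ℕ → S} {f : S}
    (h : Tendsto fn atTop (@nhds _ (sigmaTopology Θ S) f)) {j : ℕ} {q₁ q₂ : ℚ} (hq : q₁ < q₂)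
    {z : ℕ → ℝ → X} (hz : ∀ n, z n ∈ modSet X Θ j q₁ q₂) :
    Tendsto (fun n => ∫ t in Icc (q₁ : ℝ) q₂, ((fn n).1 t (z n t) - f.1 t (z n t))) atTop
      (𝓝 0) := by
  rw [NormedAddGroup.tendsto_nhds_zero]
  intro ε hε
  filter_upwards [eventually_sigmaSeminorm_lt h j hq hε] with n hn
  exact (norm_integral_sub_le_sigmaSeminorm (hS _ (fn n).2) (hS _ f.2) (hz n)).trans_lt hn

variable [BorelSpace X] [ProperSpace X] [BorelSpace Y] [SecondCountableTopology Y]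

theorem IsCarath.locallyIntegrable_comp {g : ℝ → X → Y} (hg : IsCarath g) {z : ℝ → X}
    (hz : Continuous z) {r : ℝ} (hzr : ∀ s, ‖z s‖ ≤ r) :
    LocallyIntegrable (fun s => g s (z s)) volume := by
  obtain ⟨m, hm⟩ := hg.exists_mBound_closedBall r
  exact locallyIntegrable_of_norm_le (hg.measurable_comp hz).aestronglyMeasurable hm.1
    (hm.ae_norm_comp_le hzr)

variable [NormedSpace ℝ Y]

/-- Insert `f(t, zₙ(t))`: the first difference is controlled by the seminorm uniformly over `K_j^I`,
the second by the continuity built into `WTC`. -/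
theorem tendsto_integral_comp_sub {Θ : ModFamily} {fn : ℕ → WTC X Y Θ} {f : WTC X Y Θ}
    (h : Tendsto fn atTop (@nhds _ (sigmaTopology Θ (WTC X Y Θ)) f)) {j : ℕ} {q₁ q₂ : ℚ}
    (hq : q₁ < q₂) {z : ℕ → ℝ → X} {x : ℝ → X} (hz : ∀ n, z n ∈ modSet X Θ j q₁ q₂)
    (hzc : ∀ n, Continuous (z n)) (hzj : ∀ n s, ‖z n s‖ ≤ j) (hx : Continuous x)
    (hxj : ∀ s, ‖x s‖ ≤ j) (hlim : TendstoUniformlyOn z x atTop (Icc (q₁ : ℝ) q₂)) :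
    Tendsto (fun n => ∫ t in Icc (q₁ : ℝ) q₂, ((fn n).1 t (z n t) - f.1 t (x t))) atTop
      (𝓝 0) := by
  have hxm : x ∈ modSet X Θ j q₁ q₂ :=
    mem_modSet_of_tendsto hx.continuousOn hz fun t ht => hlim.tendsto_at ht
  have h1 := tendsto_integral_sub_of_tendsto (fun g hg => hg.1) h hq hz
  have h2 := f.2.2 j q₁ q₂ hq z x hz hxm hlim
  have h3 := h1.add (h2.sub_const (∫ t in Icc (q₁ : ℝ) q₂, f.1 t (x t)))
  rw [sub_self, add_zero] at h3
  refine h3.congr fun n => ?_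
  have i1 := ((fn n).2.1.locallyIntegrable_comp (hzc n) (hzj n)).integrableOn_isCompact
    (isCompact_Icc (a := (q₁ : ℝ)) (b := q₂))
  have i2 := (f.2.1.locallyIntegrable_comp (hzc n) (hzj n)).integrableOn_isCompact
    (isCompact_Icc (a := (q₁ : ℝ)) (b := q₂))
  have i3 := (f.2.1.locallyIntegrable_comp hx hxj).integrableOn_isCompact
    (isCompact_Icc (a := (q₁ : ℝ)) (b := q₂))
  rw [integral_sub i1 i2, integral_sub i1 i3]
  abel

end Spaces

/-! ### Convergence for the nonlinear and the linear equation. -/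

section Convergence

variable {N : ℕ} {E : Set (ℝ → Eu N → Eu N)}

/-- A curve driven by `f ∈ E` along its own projection to `B_j` projects into `K_j^I`. -/
theorem ballProj_comp_mem_modSet (hE : E ⊆ LC (Eu N) (Eu N)) (hEm : HasEquicontinuousMBounds E)
    {f : ℝ → Eu N → Eu N} (hf : f ∈ E) {j : ℕ} {x₀ : Eu N} {a b : ℝ} {X : ℝ → Eu N}
    (hX : Continuous X)
    (hXi : LocallyIntegrable (fun s => f s (ballProj (j : ℝ) (X s))) volume)
    (hXe : ∀ t ∈ Icc a b, X t = x₀ + ∫ s in (0 : ℝ)..t, f s (ballProj (j : ℝ) (X s)))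
    {q₁ q₂ : ℚ} (h₁ : a ≤ q₁) (h₂ : q₂ ≤ b) :
    (fun t => ballProj (j : ℝ) (X t)) ∈ modSet (Eu N) (thetaOf E) j q₁ q₂ := by
  have hj : (0 : ℝ) ≤ j := Nat.cast_nonneg j
  have key : ∀ s ∈ Icc (q₁ : ℝ) q₂, ∀ t ∈ Icc (q₁ : ℝ) q₂, s ≤ t →
      ‖ballProj (j : ℝ) (X t) - ballProj (j : ℝ) (X s)‖ ≤ thetaOf E j q₁ q₂ (t - s) := by
    intro s hs t ht hst
    refine (norm_ballProj_sub_le hj _ _).trans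
      (le_trans ?_ (integral_optMBound_le_thetaOf hE hEm hf j hs ht hst))
    have hi := intervalIntegrable_of_locallyIntegrable hXi
    rw [hXe t ⟨h₁.trans ht.1, ht.2.trans h₂⟩, hXe s ⟨h₁.trans hs.1, hs.2.trans h₂⟩,
      add_sub_add_left_eq_sub, intervalIntegral.integral_interval_sub_left (hi _ _) (hi _ _)]
    refine intervalIntegral.norm_integral_le_of_norm_le hst ?_
      (intervalIntegrable_of_locallyIntegrable (locallyIntegrable_optMBound (hE hf) j) _ _)
    filter_upwards [ae_norm_le_optMBound (hE hf).1 j] with u hu _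
    exact hu _ (mem_closedBall_zero_iff.2 (norm_ballProj_le hj _))
  refine ⟨((continuous_ballProj hj).comp hX).continuousOn, fun t _ => norm_ballProj_le hj _,
    fun s hs t ht => ?_⟩
  rcases le_total s t with hst | hst
  · rw [norm_sub_rev, abs_sub_comm, abs_of_nonneg (sub_nonneg.2 hst)]
    exact key s hs t ht hst
  · rw [abs_of_nonneg (sub_nonneg.2 hst)]
    exact key t ht s hs hst

/-- Existence for a Lipschitz Carathéodory field truncated outside `B_j`. -/
theorem exists_truncated_solution {f : ℝ → Eu N → Eu N} (hf : f ∈ LC (Eu N) (Eu N)) (j : ℕ)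
    (x₀ : Eu N) {a b : ℝ} (ha : a ≤ 0) (hb : 0 ≤ b) :
    ∃ X : ℝ → Eu N, Continuous X ∧
      LocallyIntegrable (fun s => f s (ballProj (j : ℝ) (X s))) volume ∧
      ∀ t ∈ Icc a b, X t = x₀ + ∫ s in (0 : ℝ)..t, f s (ballProj (j : ℝ) (X s)) := by
  have hj : (0 : ℝ) ≤ j := Nat.cast_nonneg j
  obtain ⟨m, hm⟩ := hf.1.exists_mBound_closedBall (j : ℝ)
  obtain ⟨l, hl, hlip⟩ := hf.2 _ (isCompact_closedBall (0 : Eu N) (j : ℝ))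
  refine exists_integral_solution (g := fun s v => f s (ballProj (j : ℝ) v)) ?_ hm.1
    (locallyIntegrable_abs hl) ?_ ?_ ha hb x₀
  · exact hf.1.1.comp
      (measurable_fst.prodMk ((continuous_ballProj hj).measurable.comp measurable_snd))
  · filter_upwards [hm.2] with t ht
    exact ht _ (mem_closedBall_zero_iff.2 (norm_ballProj_le hj _))
  · filter_upwards [hlip] with t ht x y
    refine (ht _ (mem_closedBall_zero_iff.2 (norm_ballProj_le hj x)) _
      (mem_closedBall_zero_iff.2 (norm_ballProj_le hj y))).trans ?_
    exact mul_le_mul (le_abs_self _) (norm_ballProj_sub_le hj x y) (norm_nonneg _) (abs_nonneg _)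

/-- Convergence of the solutions of `ẋ = fₙ(t, x)`, together with the membership in the sets
`K_j^I` of globally defined curves that eventually are these solutions. -/
theorem exists_tendsto_solutions (hE : E ⊆ LC (Eu N) (Eu N)) (hEm : HasEquicontinuousMBounds E)
    {fn : ℕ → LC (Eu N) (Eu N)} {f : LC (Eu N) (Eu N)}
    (hfn : ∀ n, (fn n : ℝ → Eu N → Eu N) ∈ E)
    (hf : Tendsto fn atTop (@nhds _ (sigmaTopology (thetaOf E) (LC (Eu N) (Eu N))) f))
    {x₀n : ℕ → Eu N} {x₀ : Eu N} (hx₀ : Tendsto x₀n atTop (𝓝 x₀)) {a b : ℚ} (ha : (a : ℝ) < 0)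
    (hb : (0 : ℝ) < b) {σ : ℝ → Eu N} (hσ : IsSolutionOnIcc f.1 x₀ a b σ) :
    ∃ (j : ℕ) (x : ℝ → Eu N) (z : ℕ → ℝ → Eu N),
      Continuous x ∧ (∀ s, ‖x s‖ ≤ j) ∧ IsSolutionOnIcc f.1 x₀ a b x ∧
      (∀ n, Continuous (z n)) ∧ (∀ n s, ‖z n s‖ ≤ j) ∧
      (∀ n (q₁ q₂ : ℚ), a ≤ q₁ → q₂ ≤ b → z n ∈ modSet (Eu N) (thetaOf E) j q₁ q₂) ∧
      TendstoUniformlyOn z x atTop (Icc (a : ℝ) b) ∧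
      ∀ᶠ n in atTop, IsSolutionOnIcc (fn n).1 (x₀n n) a b (z n) := by
  obtain ⟨R, hR⟩ := isCompact_Icc.exists_bound_of_continuousOn hσ.1
  -- The margin `1` lets every curve uniformly within `1` of the solution remain in `B_j`.
  obtain ⟨j, hjR⟩ := exists_nat_ge (R + 1)
  have hj : (0 : ℝ) ≤ j := Nat.cast_nonneg j
  have hab : (a : ℝ) ≤ b := ha.le.trans hb.le
  set x : ℝ → Eu N := fun t => ballProj (j : ℝ) (IccExtend hab (fun s => σ s) t) with hxdef
  have hxc : Continuous x := (continuous_ballProj hj).comp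
    (continuousOn_iff_continuous_domRestrict.1 hσ.1).Icc_extend'
  have hxσ : EqOn σ x (Icc (a : ℝ) b) := fun t ht => by
    rw [hxdef]
    simp only [IccExtend_of_mem hab _ ht]
    exact (ballProj_of_norm_le (by linarith [hR t ht])).symm
  have hxj : ∀ s, ‖x s‖ ≤ j := fun s => norm_ballProj_le hj _
  have hx := hσ.congr ha.le hb.le hxσ
  choose X hXc hXi hXe using fun n =>
    exists_truncated_solution (fn n).2 j (x₀n n) ha.le hb.le
  set z : ℕ → ℝ → Eu N := fun n t => ballProj (j : ℝ) (X n t) with hzdef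
  have hzc : ∀ n, Continuous (z n) := fun n => (continuous_ballProj hj).comp (hXc n)
  have hzj : ∀ n s, ‖z n s‖ ≤ j := fun n s => norm_ballProj_le hj _
  have hzm : ∀ n (q₁ q₂ : ℚ), a ≤ q₁ → q₂ ≤ b → z n ∈ modSet (Eu N) (thetaOf E) j q₁ q₂ :=
    fun n q₁ q₂ h₁ h₂ => ballProj_comp_mem_modSet hE hEm (hfn n) (hXc n) (hXi n) (hXe n)
      (by exact_mod_cast h₁) (by exact_mod_cast h₂)
  have hfz : ∀ n, LocallyIntegrable (fun s => f.1 s (z n s)) volume := fun n =>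
    f.2.1.locallyIntegrable_comp (hzc n) (hzj n)
  have hfx : LocallyIntegrable (fun s => f.1 s (x s)) volume :=
    f.2.1.locallyIntegrable_comp hxc hxj
  have hD : EquiIntegrable (a : ℝ) b fun n s => (fn n).1 s (z n s) - f.1 s (z n s) := by
    obtain ⟨S, hS, hSE⟩ := hEm j
    choose μ hμS hμ using fun n => hSE _ (hfn n)
    obtain ⟨m, hm⟩ := f.2.1.exists_mBound_closedBall (j : ℝ)
    refine (hS.equiIntegrable a b hμS).of_norm_le_add (equiIntegrable_const hm.1 a b)
      (fun n => (hXi n).sub (hfz n)) fun n => ?_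
    filter_upwards [(hμ n).ae_norm_comp_le (hzj n), hm.ae_norm_comp_le (hzj n)] with s h1 h2
    exact (norm_sub_le _ _).trans (add_le_add h1 h2)
  have hDlim := fun (ε : ℝ) (hε : 0 < ε) => hD.eventually_norm_integral_le ha hb
    (fun q₁ q₂ h₁ h₁₂ h₂ => tendsto_integral_sub_of_tendsto (fun g hg => hg.1) hf h₁₂
      fun n => hzm n q₁ q₂ h₁ h₂) hε
  obtain ⟨l, hl, hlip⟩ := f.2.2 _ (isCompact_closedBall (0 : Eu N) (j : ℝ))
  have hconv : ∀ η > 0, ∀ᶠ n in atTop, ∀ t ∈ Icc (a : ℝ) b, ‖X n t - x t‖ ≤ η := by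
    intro η hη
    refine eventually_le_of_gronwall ha.le hb.le (l := fun _ => l)
      (u := fun n t => ‖X n t - x t‖) (fun _ => hl) (fun _ => le_rfl)
      (fun n => ((hXc n).sub hxc).norm.continuousOn) (fun n t _ => norm_nonneg _) ?_ hη
    intro ε hε
    have hx₀' : ∀ᶠ n in atTop, ‖x₀n n - x₀‖ < ε / 2 := by
      simpa [dist_eq_norm] using (Metric.tendsto_nhds.1 hx₀) (ε / 2) (half_pos hε)
    filter_upwards [hDlim (ε / 2) (half_pos hε), hx₀'] with n h1 h2 t ht
    have i1 := intervalIntegrable_of_locallyIntegrable (hXi n) 0 t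
    have i2 := intervalIntegrable_of_locallyIntegrable (hfz n) 0 t
    have i3 := intervalIntegrable_of_locallyIntegrable hfx 0 t
    have h3 : ‖∫ s in (0 : ℝ)..t, (f.1 s (z n s) - f.1 s (x s))‖ ≤
        |∫ s in (0 : ℝ)..t, |l s| * ‖X n s - x s‖| := by
      refine intervalIntegral.norm_integral_le_abs_of_norm_le ?_
        (intervalIntegrable_of_locallyIntegrable (locallyIntegrable_mul_continuous
          (locallyIntegrable_abs hl) ((hXc n).sub hxc).norm) _ _)
      filter_upwards [ae_restrict_of_ae hlip] with s hs
      refine (hs _ (mem_closedBall_zero_iff.2 (hzj n s)) _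
        (mem_closedBall_zero_iff.2 (hxj s))).trans ?_
      -- Since `x` is its own projection, `‖zₙ - x‖ ≤ ‖Xₙ - x‖`, and the inequality closes in `Xₙ -
      -- x`.
      have hxs : ballProj (j : ℝ) (x s) = x s := ballProj_of_norm_le (hxj s)
      refine mul_le_mul (le_abs_self _) ?_ (norm_nonneg _) (abs_nonneg _)
      rw [← hxs]
      exact (norm_ballProj_sub_le hj (X n s) (x s)).trans (by rw [hxs])
    have h4 : X n t - x t = (x₀n n - x₀) +
        (∫ s in (0 : ℝ)..t, ((fn n).1 s (z n s) - f.1 s (z n s))) +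
        ∫ s in (0 : ℝ)..t, (f.1 s (z n s) - f.1 s (x s)) := by
      rw [hXe n t ht, (hx.2 t ht).2, intervalIntegral.integral_sub i1 i2,
        intervalIntegral.integral_sub i2 i3]
      abel
    have h5 := h1 t ht
    rw [h4]
    refine (norm_add₃_le).trans ?_
    linarith
  refine ⟨j, x, z, hxc, hxj, hx, hzc, hzj, hzm, ?_, ?_⟩
  · rw [Metric.tendstoUniformlyOn_iff]
    intro ε hε
    filter_upwards [hconv (ε / 2) (half_pos hε)] with n hn t ht
    have hxs : ballProj (j : ℝ) (x t) = x t := ballProj_of_norm_le (hxj t)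
    rw [dist_comm, dist_eq_norm, ← hxs]
    have := norm_ballProj_sub_le hj (X n t) (x t)
    linarith [hn t ht]
  -- Within distance `1` of `x`, `Xₙ` has norm at most `R + 1 ≤ j`: the truncation is inactive and
  -- `Xₙ` solves the original equation.
  · filter_upwards [hconv 1 one_pos] with n hn
    have hzX : EqOn (X n) (z n) (Icc (a : ℝ) b) := by
      intro t ht
      refine (ballProj_of_norm_le ?_).symm
      have h1 := norm_sub_norm_le (X n t) (x t)
      have h2 := hR t ht
      rw [hxσ ht] at h2
      linarith [hn t ht]
    refine ⟨(hzc n).continuousOn, fun t ht =>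
      ⟨intervalIntegrable_of_locallyIntegrable (hXi n) 0 t, ?_⟩⟩
    rw [← hzX ht]
    exact hXe n t ht

/-- Convergence of the solutions of the linear equations `ẏ = Aₙ(t) y + bₙ(t)` under weak
convergence of the coefficients. -/
theorem eventually_norm_linear_solution_sub_le {Z : Type*} [NormedAddCommGroup Z]
    [NormedSpace ℝ Z] [CompleteSpace Z] {a b : ℚ} (ha : (a : ℝ) < 0) (hb : (0 : ℝ) < b)
    {An : ℕ → ℝ → (Z →L[ℝ] Z)} {A : ℝ → (Z →L[ℝ] Z)} {bn : ℕ → ℝ → Z} {β : ℝ → Z}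
    (hAn : EquiIntegrable (a : ℝ) b An) (hA : LocallyIntegrable A volume)
    (hbn : EquiIntegrable (a : ℝ) b bn) (hβ : LocallyIntegrable β volume)
    (hAlim : ∀ q₁ q₂ : ℚ, a ≤ q₁ → q₁ < q₂ → q₂ ≤ b →
      Tendsto (fun n => ∫ u in Icc (q₁ : ℝ) q₂, (An n u - A u)) atTop (𝓝 0))
    (hblim : ∀ q₁ q₂ : ℚ, a ≤ q₁ → q₁ < q₂ → q₂ ≤ b →
      Tendsto (fun n => ∫ u in Icc (q₁ : ℝ) q₂, (bn n u - β u)) atTop (𝓝 0))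
    {y₀n : ℕ → Z} {y₀ : Z} (hy₀ : Tendsto y₀n atTop (𝓝 y₀)) {yn : ℕ → ℝ → Z} {y : ℝ → Z}
    (hync : ∀ n, Continuous (yn n)) (hyc : Continuous y)
    (hyn : ∀ n, ∀ t ∈ Icc (a : ℝ) b,
      yn n t = y₀n n + ∫ s in (0 : ℝ)..t, (An n s (yn n s) + bn n s))
    (hy : ∀ t ∈ Icc (a : ℝ) b, y t = y₀ + ∫ s in (0 : ℝ)..t, (A s (y s) + β s))
    {η : ℝ} (hη : 0 < η) :
    ∀ᶠ n in atTop, ∀ t ∈ Icc (a : ℝ) b, ‖yn n t - y t‖ ≤ η := by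
  have hab : (a : ℝ) ≤ b := ha.le.trans hb.le
  have hAD : EquiIntegrable (a : ℝ) b fun n s => An n s - A s := by
    refine EquiIntegrable.of_norm_le_add (μ := fun n s => ‖An n s‖) (ν := fun _ s => ‖A s‖)
      hAn.norm (equiIntegrable_const hA a b).norm (fun n => (hAn.1 n).sub hA)
      fun n => Eventually.of_forall fun s => norm_sub_le _ _
  have hbD : EquiIntegrable (a : ℝ) b fun n s => bn n s - β s := by
    refine EquiIntegrable.of_norm_le_add (μ := fun n s => ‖bn n s‖) (ν := fun _ s => ‖β s‖)
      hbn.norm (equiIntegrable_const hβ a b).norm (fun n => (hbn.1 n).sub hβ)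
      fun n => Eventually.of_forall fun s => norm_sub_le _ _
  obtain ⟨M, hM⟩ := hAn.exists_integral_norm_le hab
  refine eventually_le_of_gronwall ha.le hb.le (l := fun n s => ‖An n s‖)
    (u := fun n t => ‖yn n t - y t‖) (M := M) hAn.norm.1 (fun n => ?_)
    (fun n => ((hync n).sub hyc).norm.continuousOn)
    (fun n t _ => norm_nonneg _) ?_ hη
  · simp only [abs_norm]
    rw [integral_Icc_eq_intervalIntegral hab]
    exact hM n
  · intro ε hε
    have hy₀' : ∀ᶠ n in atTop, ‖y₀n n - y₀‖ < ε / 3 := by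
      simpa [dist_eq_norm] using (Metric.tendsto_nhds.1 hy₀) (ε / 3) (by positivity)
    have h1 := (hAD.clm_apply hyc).eventually_norm_integral_le ha hb
      (fun q₁ q₂ h₁ h₁₂ h₂ => hAD.tendsto_integral_clm_apply hAlim hyc h₁ h₁₂ h₂)
      (ε := ε / 3) (by positivity)
    have h2 := hbD.eventually_norm_integral_le ha hb hblim (ε := ε / 3) (by positivity)
    filter_upwards [hy₀', h1, h2] with n e0 e1 e2 t ht
    have i1 := intervalIntegrable_of_locallyIntegrable
      (locallyIntegrable_clm_apply (hAn.1 n) (hync n)) 0 t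
    have i2 := intervalIntegrable_of_locallyIntegrable (hbn.1 n) 0 t
    have i3 := intervalIntegrable_of_locallyIntegrable (locallyIntegrable_clm_apply hA hyc) 0 t
    have i4 := intervalIntegrable_of_locallyIntegrable hβ 0 t
    have i5 := intervalIntegrable_of_locallyIntegrable
      (locallyIntegrable_clm_apply (hAn.1 n) hyc) 0 t
    have h3 : ‖∫ s in (0 : ℝ)..t, An n s (yn n s - y s)‖ ≤
        |∫ s in (0 : ℝ)..t, |‖An n s‖| * ‖yn n s - y s‖| := by
      refine intervalIntegral.norm_integral_le_abs_of_norm_le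
        (Eventually.of_forall fun s => ?_)
        (intervalIntegrable_of_locallyIntegrable (locallyIntegrable_mul_continuous
          (locallyIntegrable_abs (hAn.norm.1 n)) ((hync n).sub hyc).norm) _ _)
      rw [abs_norm]
      exact (An n s).le_opNorm _
    -- The weakly convergent `An n - A` is paired with the fixed curve `y`, while `An n` multiplies
    -- the unknown difference and enters Grönwall only through its norm.
    have h4 : yn n t - y t = (y₀n n - y₀) + (∫ s in (0 : ℝ)..t, (An n s - A s) (y s)) +
        (∫ s in (0 : ℝ)..t, (bn n s - β s)) + ∫ s in (0 : ℝ)..t, An n s (yn n s - y s) := by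
      simp only [sub_apply, map_sub]
      rw [hyn n t ht, hy t ht, intervalIntegral.integral_add i1 i2,
        intervalIntegral.integral_add i3 i4, intervalIntegral.integral_sub i5 i3,
        intervalIntegral.integral_sub i2 i4, intervalIntegral.integral_sub i1 i5]
      abel
    have e1' := e1 t ht
    have e2' := e2 t ht
    rw [h4]
    refine (norm_add_le _ _).trans ?_
    have := norm_add₃_le (a := y₀n n - y₀) (b := ∫ s in (0 : ℝ)..t, (An n s - A s) (y s))
      (c := ∫ s in (0 : ℝ)..t, (bn n s - β s))
    linarith

/-- Global existence for the linear equation `ẏ = F(t, x(t)) y + h(t, x(t))`. -/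
theorem exists_linear_solution {F : ℝ → Eu N → (Eu N →L[ℝ] Eu N)} {h : ℝ → Eu N → Eu N}
    (hF : IsCarath F) (hh : IsCarath h) {x : ℝ → Eu N} (hx : Continuous x) {r : ℝ}
    (hxr : ∀ s, ‖x s‖ ≤ r) (y₀ : Eu N) {a b : ℝ} (ha : a ≤ 0) (hb : 0 ≤ b) :
    ∃ y : ℝ → Eu N, Continuous y ∧
      IsSolutionOnIcc (fun t y => F t (x t) y + h t (x t)) y₀ a b y := by
  obtain ⟨m, hm⟩ := hF.exists_mBound_closedBall r
  obtain ⟨k, hk⟩ := hh.exists_mBound_closedBall r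
  have hmeas : Measurable (Function.uncurry fun t y => F t (x t) y + h t (x t)) := by
    refine Measurable.add ?_ ((hh.measurable_comp hx).comp measurable_fst)
    exact isBoundedBilinearMap_apply.continuous.measurable.comp
      (((hF.measurable_comp hx).comp measurable_fst).prodMk measurable_snd)
  have hbound : ∀ᵐ t, ‖F t (x t) 0 + h t (x t)‖ ≤ k t := by
    filter_upwards [hk.ae_norm_comp_le hxr] with t ht
    rwa [map_zero, zero_add]
  have hlip : ∀ᵐ t, ∀ y y' : Eu N,
      ‖F t (x t) y + h t (x t) - (F t (x t) y' + h t (x t))‖ ≤ m t * ‖y - y'‖ := by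
    filter_upwards [hm.ae_norm_comp_le hxr] with t ht y y'
    rw [add_sub_add_right_eq_sub, ← map_sub]
    exact (F t (x t)).le_of_opNorm_le ht _
  obtain ⟨y, hyc, hyi, hye⟩ := exists_integral_solution hmeas hk.1 hm.1 hbound hlip ha hb y₀
  exact ⟨y, hyc, hyc.continuousOn, fun t ht =>
    ⟨intervalIntegrable_of_locallyIntegrable hyi 0 t, hye t ht⟩⟩

theorem HasEquicontinuousMBounds.equiIntegrable_comp {Y : Type*} [NormedAddCommGroup Y]
    [MeasurableSpace Y] [BorelSpace Y] [SecondCountableTopology Y] {B : Set (ℝ → Eu N → Y)}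
    (hB : HasEquicontinuousMBounds B) {G : ℕ → ℝ → Eu N → Y} (hG : ∀ n, G n ∈ B)
    (hGc : ∀ n, IsCarath (G n)) {j : ℕ} {z : ℕ → ℝ → Eu N} (hz : ∀ n, Continuous (z n))
    (hzj : ∀ n s, ‖z n s‖ ≤ j) (a b : ℝ) : EquiIntegrable a b fun n s => G n s (z n s) := by
  obtain ⟨S, hS, hSB⟩ := hB j
  choose μ hμS hμ using fun n => hSB _ (hG n)
  refine (hS.equiIntegrable a b hμS).of_norm_le_add (equiIntegrable_const (m := fun _ => 0)
    locallyIntegrable_zero a b) (fun n => (hGc n).locallyIntegrable_comp (hz n) (hzj n)) fun n => ?_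
  filter_upwards [(hμ n).ae_norm_comp_le (hzj n)] with s hs
  rwa [add_zero]

end Convergence

end Carath

/-! ### The theorem. -/

open Carath in
theorem mainTheorem2 (N : ℕ)
    (E : Set (ℝ → Eu N → Eu N)) (hE : E ⊆ LC (Eu N) (Eu N))
    (hEm : HasEquicontinuousMBounds E)
    (fn : ℕ → LC (Eu N) (Eu N)) (f : LC (Eu N) (Eu N))
    (hfn : ∀ n, (fn n : ℝ → Eu N → Eu N) ∈ E)
    (hf : Tendsto fn atTop (@nhds _ (sigmaTopology (thetaOf E) (LC (Eu N) (Eu N))) f))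
    (x₀n : ℕ → Eu N) (x₀ : Eu N) (hx₀ : Tendsto x₀n atTop (𝓝 x₀)) :
    -- (i)
    (∀ T₁ T₂ : ℝ, Icc T₁ T₂ ⊆ solInterval f.1 x₀ →
      (∀ᶠ n in atTop, Icc T₁ T₂ ⊆ solInterval (fn n).1 (x₀n n)) ∧
      TendstoUniformlyOn (fun n => sol (fn n).1 (x₀n n)) (sol f.1 x₀) atTop (Icc T₁ T₂)) ∧
    -- (ii)
    (∀ (B : Set (ℝ → Eu N → (Eu N →L[ℝ] Eu N))) (C : Set (ℝ → Eu N → Eu N)),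
      B ⊆ WTC (Eu N) (Eu N →L[ℝ] Eu N) (thetaOf E) → HasEquicontinuousMBounds B →
      C ⊆ WTC (Eu N) (Eu N) (thetaOf E) → HasEquicontinuousMBounds C →
      ∀ (Fn : ℕ → WTC (Eu N) (Eu N →L[ℝ] Eu N) (thetaOf E))
        (F : WTC (Eu N) (Eu N →L[ℝ] Eu N) (thetaOf E))
        (hn : ℕ → WTC (Eu N) (Eu N) (thetaOf E)) (h : WTC (Eu N) (Eu N) (thetaOf E))
        (y₀n : ℕ → Eu N) (y₀ : Eu N),
      (∀ n, (Fn n : ℝ → Eu N → (Eu N →L[ℝ] Eu N)) ∈ B) →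
      (∀ n, (hn n : ℝ → Eu N → Eu N) ∈ C) →
      Tendsto Fn atTop (@nhds _ (sigmaTopology (thetaOf E) _) F) →
      Tendsto hn atTop (@nhds _ (sigmaTopology (thetaOf E) _) h) →
      Tendsto y₀n atTop (𝓝 y₀) →
      ∀ T₁ T₂ : ℝ, Icc T₁ T₂ ⊆ solInterval f.1 x₀ →
        Icc T₁ T₂ ⊆ solInterval (triangular f.1 F.1 h.1) (x₀, y₀) ∧
        (∀ᶠ n in atTop, Icc T₁ T₂ ⊆
          solInterval (triangular (fn n).1 (Fn n).1 (hn n).1) (x₀n n, y₀n n)) ∧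
        TendstoUniformlyOn
          (fun n t => (sol (triangular (fn n).1 (Fn n).1 (hn n).1) (x₀n n, y₀n n) t).2)
          (fun t => (sol (triangular f.1 F.1 h.1) (x₀, y₀) t).2) atTop (Icc T₁ T₂)) := by
  constructor
  · intro T₁ T₂ hT
    rcases lt_or_ge T₂ T₁ with hlt | hle
    · simp [Icc_eq_empty_of_lt hlt, tendstoUniformlyOn_empty]
    obtain ⟨a, b, ha, hb, hsub, hsa, hsb⟩ := exists_Icc_rat_subset_solInterval hT hle
    obtain ⟨j, x, z, -, -, hx, -, -, -, hzx, hz⟩ := exists_tendsto_solutions hE hEm hfn hf hx₀ ha hb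
      ((hasUniqueSolutions_of_mem_LC f.2 x₀).isSolutionOnIcc_sol hsa hsb)
    refine ⟨?_, ?_⟩
    · filter_upwards [hz] with n hn t ht
      exact ⟨z n, a, b, hn.isSolutionOn ha hb, hsub ht⟩
    · refine ((hzx.mono (hsub.trans Ioo_subset_Icc_self)).congr ?_).congr_right ?_
      · filter_upwards [hz] with n hn t ht
        exact ((hasUniqueSolutions_of_mem_LC (fn n).2 _).sol_eq
          (hn.isSolutionOn ha hb) (hsub ht)).symm
      · intro t ht
        exact ((hasUniqueSolutions_of_mem_LC f.2 _).sol_eq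
          (hx.isSolutionOn ha hb) (hsub ht)).symm
  · intro B C _ hB _ hC Fn F hn h y₀n y₀ hFB hhC hF hh hy₀ T₁ T₂ hT
    rcases lt_or_ge T₂ T₁ with hlt | hle
    · simp [Icc_eq_empty_of_lt hlt, tendstoUniformlyOn_empty]
    obtain ⟨a, b, ha, hb, hsub, hsa, hsb⟩ := exists_Icc_rat_subset_solInterval hT hle
    obtain ⟨j, x, z, hxc, hxj, hx, hzc, hzj, hzm, hzx, hz⟩ :=
      exists_tendsto_solutions hE hEm hfn hf hx₀ ha hb
        ((hasUniqueSolutions_of_mem_LC f.2 x₀).isSolutionOnIcc_sol hsa hsb)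
    obtain ⟨y, hyc, hy⟩ := exists_linear_solution F.2.1 h.2.1 hxc hxj y₀ ha.le hb.le
    -- The linear equations are driven by `z n` for every `n`; `(z n, yn n)` solves the triangular
    -- system only once `z n` solves the base equation, which holds for large `n`.
    choose yn hync hyn using fun n =>
      exists_linear_solution (Fn n).2.1 (hn n).2.1 (hzc n) (hzj n) (y₀n n) ha.le hb.le
    have hsubI : ∀ q₁ q₂ : ℚ, a ≤ q₁ → q₂ ≤ b → Icc (q₁ : ℝ) q₂ ⊆ Icc (a : ℝ) b :=
      fun q₁ q₂ h₁ h₂ => Icc_subset_Icc (by exact_mod_cast h₁) (by exact_mod_cast h₂)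
    have hconv := fun (η : ℝ) (hη : 0 < η) => eventually_norm_linear_solution_sub_le ha hb
      (hB.equiIntegrable_comp hFB (fun n => (Fn n).2.1) hzc hzj a b)
      (F.2.1.locallyIntegrable_comp hxc hxj)
      (hC.equiIntegrable_comp hhC (fun n => (hn n).2.1) hzc hzj a b)
      (h.2.1.locallyIntegrable_comp hxc hxj)
      (fun q₁ q₂ h₁ h₁₂ h₂ => tendsto_integral_comp_sub hF h₁₂
        (fun n => hzm n q₁ q₂ h₁ h₂) hzc hzj hxc hxj (hzx.mono (hsubI q₁ q₂ h₁ h₂)))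
      (fun q₁ q₂ h₁ h₁₂ h₂ => tendsto_integral_comp_sub hh h₁₂
        (fun n => hzm n q₁ q₂ h₁ h₂) hzc hzj hxc hxj (hzx.mono (hsubI q₁ q₂ h₁ h₂)))
      hy₀ hync hyc (fun n t ht => ((hyn n).2 t ht).2) (fun t ht => (hy.2 t ht).2) hη
    have hsol := (isSolutionOnIcc_triangular hx hy).isSolutionOn ha hb
    refine ⟨fun t ht => ⟨_, a, b, hsol, hsub ht⟩, ?_, ?_⟩
    · filter_upwards [hz] with n hzn t ht
      exact ⟨_, a, b, (isSolutionOnIcc_triangular hzn (hyn n)).isSolutionOn ha hb, hsub ht⟩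
    · rw [Metric.tendstoUniformlyOn_iff]
      intro ε hε
      filter_upwards [hz, hconv (ε / 2) (half_pos hε)] with n hzn hn' t ht
      rw [(hasUniqueSolutions_triangular f.2 F.2.1).sol_eq hsol (hsub ht),
        (hasUniqueSolutions_triangular (fn n).2 (Fn n).2.1).sol_eq
          ((isSolutionOnIcc_triangular hzn (hyn n)).isSolutionOn ha hb) (hsub ht),
        dist_comm, dist_eq_norm]
      linarith [hn' t (Ioo_subset_Icc_self (hsub ht))]
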